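/- Let $\gamma\colon\mathbb{R}\to\mathbb{R}^2$ be a regular $C^\infty$ parametrization, periodic with period $L>0$ and injective on $[0,L)$, of a smooth simple closed plane curve (denoted by the same letter $\gamma$). Let $\tau(t)=\gamma'(t)/|\gamma'(t)|$ be its unit tangent vector, $\nu(t)$ the vector $\tau(t)$ rotated counterclockwise by $\pi/2$, and $k(t)$ its signed curvature, that is, $\tau'(t)=|\gamma'(t)|\,k(t)\,\nu(t)$. The osculating circle $\sigma_t$ of $\gamma$ at $t$ is the circle of radius $1/|k(t)|$ centered at $\gamma(t)+\frac1{k(t)}\nu(t)$ if $k(t)\neq0$, and the tangent line of $\gamma$ at $t$ if $k(t)=0$. The curve $\gamma$ cuts the plane into two closed regions, a bounded one (the inside) and an unbounded one (the outside). We say that $\sigma_t$ supports $\gamma$ at $\gamma(t)$ from inside (respectively, from outside) if $\gamma$ lies in one of the two closed regions into which $\sigma_t$ cuts the plane and $\sigma_t$ lies in the bounded (respectively, unbounded) closed region of $\gamma$. Then there are four distinct points on $\gamma$ such that the osculating circles at two of them support $\gamma$ from inside, and the osculating circles at the other two support $\gamma$ from outside. Moreover, $\gamma$ has at least four vertices;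 that is, there are at least four distinct points $\gamma(t)$ with $k'(t)=0$. -/

import Mathlib

open scoped ContDiff

/-- The Euclidean plane. -/
abbrev Plane : Type := EuclideanSpace ℝ (Fin 2)

namespace PlaneCurve

noncomputable section

/-- Counterclockwise rotation of the plane by the angle `π / 2`. -/
def rot (v : Plane) : Plane := !₂[-(v 1), v 0]

/-- `γ : ℝ → Plane` is a parametrization, with period `L > 0`, of a smooth simple closed plane
curve: it is smooth, regular, `L`-periodic, and injective on a period. -/
structure IsSmoothSimpleClosed (γ : ℝ → Plane) (L : ℝ) : Prop where
  period_pos : 0 < L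
  smooth : ContDiff ℝ ∞ γ
  regular : ∀ t, deriv γ t ≠ 0
  periodic : Function.Periodic γ L
  simple : Set.InjOn γ (Set.Ico 0 L)

/-- The unit tangent vector of a regular curve. -/
def tangent (γ : ℝ → Plane) (t : ℝ) : Plane := ‖deriv γ t‖⁻¹ • deriv γ t

/-- The unit normal vector: the unit tangent vector turned counterclockwise by a right angle, so
that `tangent γ t, normal γ t` is an oriented orthonormal basis (the Frenet frame). -/
def normal (γ : ℝ → Plane) (t : ℝ) : Plane := rot (tangent γ t)

/-- The signed curvature `k` of a regular curve: the derivative of the unit tangent vector with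
respect to arc length is `k` times the unit normal vector. -/
def signedCurvature (γ : ℝ → Plane) (t : ℝ) : ℝ :=
  inner ℝ (deriv (tangent γ) t) (normal γ t) / ‖deriv γ t‖

/-- The curve `γ` has a vertex at the parameter `t`: a critical point of its signed curvature. -/
def IsVertex (γ : ℝ → Plane) (t : ℝ) : Prop := deriv (signedCurvature γ) t = 0

/-- The osculating circle of `γ` at `t`, as a subset of the plane. With `k` the signed curvature
of `γ` at `t`, it is the tangent line if `k = 0`, and otherwise the circle of radius `1 / |k|`
whose center is `γ t + (1 / k) • normal γ t`. -/
def osculatingCircle (γ : ℝ → Plane) (t : ℝ) : Set Plane :=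
  if signedCurvature γ t = 0 then
    Set.range fun s : ℝ => γ t + s • tangent γ t
  else
    Metric.sphere (γ t + (signedCurvature γ t)⁻¹ • normal γ t) |signedCurvature γ t|⁻¹

/-- The closed region inside the curve `K`: the closure of the union of the bounded connected
components of the complement of `K`. -/
def insideRegion (K : Set Plane) : Set Plane :=
  closure {x | x ∈ Kᶜ ∧ Bornology.IsBounded (connectedComponentIn Kᶜ x)}

/-- The closed region outside the curve `K`: the closure of the union of the unbounded connected
components of the complement of `K`. -/
def outsideRegion (K : Set Plane) : Set Plane :=
  closure {x | x ∈ Kᶜ ∧ ¬ Bornology.IsBounded (connectedComponentIn Kᶜ x)}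

/-- The curve `C` globally supports the curve `K` at the point `p`: the point `p` is common to
both, and `K` lies in one of the closed regions into which `C` divides the plane. -/
def GloballySupports (C K : Set Plane) (p : Plane) : Prop :=
  p ∈ C ∧ p ∈ K ∧ ∃ x ∈ Cᶜ, K ⊆ closure (connectedComponentIn Cᶜ x)

/-- The curve `C` supports the simple closed curve `K` at `p` from inside. -/
def SupportsFromInside (C K : Set Plane) (p : Plane) : Prop :=
  GloballySupports C K p ∧ C ⊆ insideRegion K

/-- The curve `C` supports the simple closed curve `K` at `p` from outside. -/
def SupportsFromOutside (C K : Set Plane) (p : Plane) : Prop :=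
  GloballySupports C K p ∧ C ⊆ outsideRegion K

end

end PlaneCurve

namespace PlaneCurve

open Set Filter Topology

/-! At a point of the curve, grow a disc tangent from the left until it can grow no further.
Generalized discs are allowed: half-planes and exteriors of circles count too. The growth stops
because the disc either becomes osculating or touches the curve at a second point
(`IsJordan.osc_or_contact`). In the first case the osculating circle supports the curve from the
left.

Each contact pair yields a supporting osculating circle on both arcs that it cuts off. Among the
contact pairs in a closed arc take one at minimal parameter distance and look at the midpoint
between its two parameters. A second contact of the disc at the midpoint would either give a closer
pair or interlace with the minimal one. Two empty discs on the same side cannot touch the curve at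
interlaced pairs unless they share the contact point (`IsIncircle.dist_eq_of_interlaced`), which
again gives a closer pair. Hence there are at least two such circles on the left and, after
reversing the orientation, two on the right.

The interlacing argument uses chords and so needs round discs. A Möbius map with pole on the right
of the curve makes every empty left disc bounded, and it preserves tangency and osculation
(`boundedDiscs_mobius`, `osc_mobius_iff`).

In place of the Jordan curve theorem the proof uses the Cauchy integral of `dw / (w - z)`: it is
locally constant off a closed curve and jumps by `2πi` across it (`tendsto_arcIntegral_jump`). So
the curve separates its left side from its right side, and exactly one of the two lies in a bounded
component. A supporting osculating circle meets the curve to third order without crossing it, so the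
third-order term of the contact vanishes, and that is the vertex condition.

All of this is computed in the coordinate `w = g' t / (z - g t)`, in which the generalized circles
tangent at `g t` become the lines of constant `Im w`. -/

/-- A smooth regular `L`-periodic parametrization of a simple closed curve in `ℂ`. -/
structure IsJordan (g : ℝ → ℂ) (L : ℝ) : Prop where
  pos : 0 < L
  smooth : ContDiff ℝ ∞ g
  regular : ∀ t, deriv g t ≠ 0
  periodic : Function.Periodic g L
  inj : ∀ s t, s < t → t < s + L → g s ≠ g t

/-- Half of the signed curvature of the circle tangent to `g` at `t` and passing through `g s`,
multiplied by the speed of `g` at `t`. -/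
noncomputable def lam (g : ℝ → ℂ) (t s : ℝ) : ℝ := -(deriv g t / (g s - g t)).im

/-- Half of the signed curvature of `g` at `t`, multiplied by the speed. -/
noncomputable def osc (g : ℝ → ℂ) (t : ℝ) : ℝ := (deriv (deriv g) t / deriv g t).im / 2

/-- The curve lies in the complement of the open generalized disc tangent at `g t` with
parameter `c`. -/
def Supp (g : ℝ → ℂ) (t c : ℝ) : Prop := ∀ r, g r ≠ g t → lam g t r ≤ c

/-- The osculating circle supports the curve from the left. -/
def Osc (g : ℝ → ℂ) (t : ℝ) : Prop := Supp g t (osc g t)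

/-- The extension of `lam` to the diagonal. -/
noncomputable def lamc (g : ℝ → ℂ) (t s : ℝ) : ℝ := if s = t then osc g t else lam g t s

/-! ### Divided differences -/

/-- The first divided difference of `g`. -/
noncomputable def divDiff (g : ℝ → ℂ) (t s : ℝ) : ℂ :=
  ∫ θ in (0 : ℝ)..1, deriv g (t + θ * (s - t))

/-- The second divided difference of `g` with a double node at `t`. -/
noncomputable def divDiff₂ (g : ℝ → ℂ) (t s : ℝ) : ℂ :=
  ∫ θ in (0 : ℝ)..1, (θ : ℂ) * divDiff (deriv g) t (t + θ * (s - t))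

theorem contDiff_deriv {g : ℝ → ℂ} (hg : ContDiff ℝ ∞ g) : ContDiff ℝ ∞ (deriv g) :=
  (contDiff_infty_iff_deriv.1 hg).2

theorem divDiff_mul {g : ℝ → ℂ} (hg : ContDiff ℝ ∞ g) (t s : ℝ) :
    (s - t) * divDiff g t s = g s - g t := by
  rcases eq_or_ne s t with rfl | h
  · simp
  have h' : s - t ≠ 0 := sub_ne_zero.2 h
  have h1 := intervalIntegral.integral_comp_mul_add (a := 0) (b := 1) (fun x => deriv g x) h' t
  have h2 : ∫ x in t..s, deriv g x = g s - g t :=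
    intervalIntegral.integral_deriv_eq_sub
      (fun x _ => (hg.differentiable (by simp)) x)
      ((contDiff_deriv hg).continuous.intervalIntegrable _ _)
  have h3 : divDiff g t s = (s - t)⁻¹ • ∫ x in t..s, deriv g x := by
    rw [divDiff]
    convert h1 using 3
    · congr 1; ring
    · ring
    · ring
  rw [h3, h2, Complex.real_smul]
  push_cast
  have : (s : ℂ) - t ≠ 0 := by exact_mod_cast h'
  field_simp

theorem continuous_divDiff {g : ℝ → ℂ} (hg : ContDiff ℝ ∞ g) :
    Continuous fun p : ℝ × ℝ => divDiff g p.1 p.2 := by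
  unfold divDiff
  have := (contDiff_deriv hg).continuous
  apply intervalIntegral.continuous_parametric_intervalIntegral_of_continuous'
  simp only [Function.uncurry_def]
  fun_prop

theorem continuous_divDiff₂ {g : ℝ → ℂ} (hg : ContDiff ℝ ∞ g) :
    Continuous fun p : ℝ × ℝ => divDiff₂ g p.1 p.2 := by
  unfold divDiff₂
  have := continuous_divDiff (contDiff_deriv hg)
  apply intervalIntegral.continuous_parametric_intervalIntegral_of_continuous'
  simp only [Function.uncurry_def]
  refine Continuous.mul (by fun_prop) ?_
  exact this.comp (f := fun x : (ℝ × ℝ) × ℝ => (x.1.1, x.1.1 + x.2 * (x.1.2 - x.1.1)))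
    (by fun_prop)

theorem divDiff_self {g : ℝ → ℂ} (t : ℝ) : divDiff g t t = deriv g t := by
  simp [divDiff]

theorem divDiff₂_self {g : ℝ → ℂ} (t : ℝ) : divDiff₂ g t t = deriv (deriv g) t / 2 := by
  simp only [divDiff₂, sub_self, mul_zero, add_zero, divDiff_self]
  rw [intervalIntegral.integral_mul_const]
  have : ∫ θ in (0 : ℝ)..1, (θ : ℂ) = ((∫ θ in (0 : ℝ)..1, θ : ℝ) : ℂ) :=
    intervalIntegral.integral_ofReal
  rw [this, integral_id]
  push_cast
  ring

theorem divDiff_eq {g : ℝ → ℂ} (hg : ContDiff ℝ ∞ g) (t s : ℝ) :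
    divDiff g t s = deriv g t + (s - t) * divDiff₂ g t s := by
  have h1 : divDiff g t s - deriv g t =
      ∫ θ in (0 : ℝ)..1, (deriv g (t + θ * (s - t)) - deriv g t) := by
    rw [intervalIntegral.integral_sub]
    · simp [divDiff]
    · apply Continuous.intervalIntegrable
      have := (contDiff_deriv hg).continuous
      fun_prop
    · simp
  have h2 : (s - t) * divDiff₂ g t s =
      ∫ θ in (0 : ℝ)..1, (deriv g (t + θ * (s - t)) - deriv g t) := by
    rw [divDiff₂, ← intervalIntegral.integral_const_mul]
    congr 1
    ext θ
    rw [← divDiff_mul (contDiff_deriv hg)]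
    push_cast
    ring
  rw [h2, ← h1]
  ring

namespace IsJordan

variable {g : ℝ → ℂ} {L : ℝ}

theorem ne_of_abs_lt (hg : IsJordan g L) {s t : ℝ} (h : s ≠ t) (h' : |s - t| < L) : g s ≠ g t := by
  rw [abs_lt] at h'
  rcases lt_or_gt_of_ne h with h1 | h1
  · exact hg.inj s t h1 (by linarith)
  · exact (hg.inj t s h1 (by linarith)).symm

theorem divDiff_ne_zero (hg : IsJordan g L) {s t : ℝ} (h' : |s - t| < L) : divDiff g t s ≠ 0 := by
  rcases eq_or_ne s t with rfl | h
  · rw [divDiff_self]; exact hg.regular s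
  · intro h0
    have := divDiff_mul hg.smooth t s
    rw [h0, mul_zero] at this
    exact hg.ne_of_abs_lt h h' (sub_eq_zero.1 this.symm)

/-- By the divided difference expansion, `g' t / (g s - g t)` is `1 / (s - t)` minus `divDiff₂ /
divDiff`. The singular term is real, so it disappears from the imaginary part. This shows that `osc`
is the right value on the diagonal and makes `lamc` jointly continuous there. -/
theorem lamc_eq (hg : IsJordan g L) {s t : ℝ} (h' : |s - t| < L) :
    lamc g t s = (divDiff₂ g t s / divDiff g t s).im := by
  have hG := hg.divDiff_ne_zero h'
  unfold lamc
  split_ifs with h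
  · subst h
    rw [divDiff_self, divDiff₂_self, osc, div_right_comm]
    simp
  · have h1 : (s : ℂ) - t ≠ 0 := by exact_mod_cast sub_ne_zero.2 h
    have h2 : deriv g t / (g s - g t) =
        (((s - t)⁻¹ : ℝ) : ℂ) - divDiff₂ g t s / divDiff g t s := by
      rw [← divDiff_mul hg.smooth]
      have := divDiff_eq hg.smooth t s
      push_cast
      field_simp
      rw [this]; ring
    rw [lam, h2, Complex.sub_im, Complex.ofReal_im]
    ring

theorem continuousOn_lamc (hg : IsJordan g L) :
    ContinuousOn (fun p : ℝ × ℝ => lamc g p.1 p.2) {p | |p.2 - p.1| < L} := by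
  have : ContinuousOn (fun p : ℝ × ℝ => (divDiff₂ g p.1 p.2 / divDiff g p.1 p.2).im)
      {p | |p.2 - p.1| < L} := by
    apply Complex.continuous_im.comp_continuousOn
    exact (continuous_divDiff₂ hg.smooth).continuousOn.div
      (continuous_divDiff hg.smooth).continuousOn (fun p hp => hg.divDiff_ne_zero hp)
  exact this.congr fun p hp => hg.lamc_eq hp

theorem periodic_deriv (hg : IsJordan g L) : Function.Periodic (deriv g) L := by
  intro t
  have : (fun x => g (x + L)) = g := funext hg.periodic
  rw [← deriv_comp_add_const, this]

theorem continuous_deriv (hg : IsJordan g L) : Continuous (deriv g) :=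
  (contDiff_deriv hg.smooth).continuous

theorem differentiable (hg : IsJordan g L) : Differentiable ℝ g :=
  hg.smooth.differentiable (by simp)

/-- Every parameter is congruent to one in a window of length `L`. -/
theorem exists_window (hg : IsJordan g L) (a r : ℝ) :
    ∃ r' ∈ Ico a (a + L), g r' = g r ∧ deriv g r' = deriv g r := by
  obtain ⟨n, hn⟩ := existsUnique_add_zsmul_mem_Ico hg.pos r a
  refine ⟨_, hn.1, ?_, ?_⟩
  · have := hg.periodic.zsmul n r; exact this
  · have := hg.periodic_deriv.zsmul n r; exact this

/-- The largest left disc that misses the curve has as parameter the maximum of `lamc` over one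
period. The window is centered at `t` so that the other parameters of the point `g t`, where `lam`
is singular, stay outside. -/
theorem exists_contact (hg : IsJordan g L) (t : ℝ) :
    ∃ s, t - L / 2 ≤ s ∧ s ≤ t + L / 2 ∧ Supp g t (lamc g t s) := by
  have hL := hg.pos
  have hc : ContinuousOn (fun s => lamc g t s) (Icc (t - L / 2) (t + L / 2)) := by
    refine hg.continuousOn_lamc.comp (f := fun s => (t, s)) (by fun_prop) ?_
    intro s hs
    simp only [mem_ofPred_eq, abs_lt]
    exact ⟨by linarith [hs.1], by linarith [hs.2]⟩
  obtain ⟨s, hs, hmax⟩ := isCompact_Icc.exists_isMaxOn ⟨t, by constructor <;> linarith⟩ hc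
  refine ⟨s, hs.1, hs.2, fun r hr => ?_⟩
  obtain ⟨r', hr', h1, -⟩ := hg.exists_window (t - L / 2) r
  have h2 : lamc g t r' ≤ lamc g t s := hmax ⟨hr'.1, by linarith [hr'.2]⟩
  rw [lamc, if_neg (by rintro rfl; exact hr h1.symm)] at h2
  simpa only [lam, h1] using h2

theorem exists_bound (hg : IsJordan g L) :
    ∃ K > 0, ∀ t s, |lam g t s| < K := by
  have hL := hg.pos
  have hc : ContinuousOn (fun p : ℝ × ℝ => lamc g p.1 (p.1 + p.2))
      (Icc 0 L ×ˢ Icc (-(L / 2)) (L / 2)) := by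
    refine hg.continuousOn_lamc.comp (f := fun p : ℝ × ℝ => (p.1, p.1 + p.2)) (by fun_prop) ?_
    rintro ⟨t, s⟩ ⟨-, hs⟩
    simp only [mem_ofPred_eq, abs_lt]
    exact ⟨by linarith [hs.1], by linarith [hs.2]⟩
  obtain ⟨K, hK⟩ := (isCompact_Icc.prod isCompact_Icc).exists_bound_of_continuousOn hc
  refine ⟨max K 0 + 1, by positivity, fun t s => ?_⟩
  -- At coinciding points division by zero makes `lam` equal to `0`.
  by_cases h : g s = g t
  · simp [lam, h]; positivity
  obtain ⟨t', ht', h1, h2⟩ := hg.exists_window 0 t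
  obtain ⟨s', hs', h3, -⟩ := hg.exists_window (t' - L / 2) s
  have h4 := hK (t', s' - t') ⟨⟨ht'.1, by linarith [ht'.2]⟩, by linarith [hs'.1], by linarith [hs'.2]⟩
  simp only [add_sub_cancel, Real.norm_eq_abs] at h4
  rw [lamc, if_neg (by rintro rfl; exact h (by rw [← h3, ← h1]))] at h4
  have : lam g t' s' = lam g t s := by simp only [lam, h1, h2, h3]
  rw [this] at h4
  linarith [le_max_left K 0]

end IsJordan

/-! ### The Cauchy integral of an arc and its jump -/

open MeasureTheory

/-- The integral of `dw / (w - z)` along the arc `f` restricted to `[a, b]`. -/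
noncomputable def arcIntegral (f : ℝ → ℂ) (a b : ℝ) (z : ℂ) : ℂ :=
  ∫ u in a..b, deriv f u / (f u - z)

/-- Differentiating under the integral gives `f' / (f - z) ^ 2`, which has the primitive `-(f -
z)⁻¹`, so only the endpoints contribute. For closed curves the contributions cancel and the integral
is locally constant off the curve. -/
theorem hasDerivAt_arcIntegral {f : ℝ → ℂ} (hf : ContDiff ℝ ∞ f) {a b : ℝ} (hab : a ≤ b) {z : ℂ}
    (hz : z ∉ f '' Icc a b) :
    HasDerivAt (arcIntegral f a b) ((f a - z)⁻¹ - (f b - z)⁻¹) z := by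
  have hc := hf.continuous
  have hc' := (contDiff_deriv hf).continuous
  have hK : IsCompact (f '' Icc a b) := isCompact_Icc.image hc
  obtain ⟨δ, hδ, hball⟩ := Metric.isOpen_iff.1 hK.isClosed.isOpen_compl z hz
  have hfar : ∀ u ∈ Icc a b, ∀ w ∈ Metric.ball z (δ / 2), δ / 2 ≤ ‖f u - w‖ := by
    intro u hu w hw
    by_contra! h
    have : f u ∈ Metric.ball z δ := by
      rw [Metric.mem_ball, dist_eq_norm] at *
      calc ‖f u - z‖ = ‖(f u - w) + (w - z)‖ := by congr 1; ring
        _ ≤ _ := norm_add_le _ _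
        _ < δ := by linarith
    exact hball this ⟨u, hu, rfl⟩
  have hne : ∀ u ∈ Icc a b, ∀ w ∈ Metric.ball z (δ / 2), f u - w ≠ 0 := fun u hu w hw h => by
    have := hfar u hu w hw
    rw [h, norm_zero] at this
    linarith
  have hz' : z ∈ Metric.ball z (δ / 2) := Metric.mem_ball_self (by linarith)
  have hcont : ∀ w ∈ Metric.ball z (δ / 2), ContinuousOn (fun u => deriv f u / (f u - w)) (uIcc a b) := by
    intro w hw
    rw [uIcc_of_le hab]
    exact hc'.continuousOn.div (by fun_prop) (fun u hu => hne u hu w hw)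
  have hcont2 : ContinuousOn (fun u => deriv f u / (f u - z) ^ 2) (uIcc a b) := by
    rw [uIcc_of_le hab]
    exact hc'.continuousOn.div (by fun_prop) (fun u hu => pow_ne_zero _ (hne u hu z hz'))
  have key := intervalIntegral.hasDerivAt_integral_of_dominated_loc_of_deriv_le (𝕜 := ℂ)
    (μ := volume) (a := a) (b := b) (x₀ := z) (s := Metric.ball z (δ / 2))
    (F := fun w u => deriv f u / (f u - w)) (F' := fun w u => deriv f u / (f u - w) ^ 2)
    (bound := fun u => ‖deriv f u‖ / (δ / 2) ^ 2) (Metric.ball_mem_nhds _ (by linarith))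
    (by
      filter_upwards [Metric.ball_mem_nhds z (show 0 < δ / 2 by linarith)] with w hw
      exact intervalIntegrable_iff.1 (hcont w hw).intervalIntegrable |>.aestronglyMeasurable)
    ((hcont z hz').intervalIntegrable)
    (intervalIntegrable_iff.1 hcont2.intervalIntegrable).aestronglyMeasurable
    (by
      refine Eventually.of_forall fun u hu w hw => ?_
      rw [uIoc_of_le hab] at hu
      rw [norm_div, norm_pow]
      have := hfar u (Ioc_subset_Icc_self hu) w hw
      gcongr)
    (by apply Continuous.intervalIntegrable; fun_prop)
    (by
      refine Eventually.of_forall fun u hu w hw => ?_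
      rw [uIoc_of_le hab] at hu
      have h0 := hne u (Ioc_subset_Icc_self hu) w hw
      have h1 : HasDerivAt (fun w => f u - w) (-1) w := by
        simpa using (hasDerivAt_id w).const_sub (f u)
      exact ((hasDerivAt_const w (deriv f u)).fun_div h1 h0).congr_deriv (by simp))
  have hint : ∫ u in a..b, deriv f u / (f u - z) ^ 2 = (f a - z)⁻¹ - (f b - z)⁻¹ := by
    rw [intervalIntegral.integral_eq_sub_of_hasDerivAt (f := fun u => -(f u - z)⁻¹) _
      hcont2.intervalIntegrable]
    · ring
    · intro u hu
      rw [uIcc_of_le hab] at hu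
      have h0 := hne u hu z hz'
      have h1 : HasDerivAt (fun u => f u - z) (deriv f u) u :=
        ((hf.differentiable (by simp)) u).hasDerivAt.sub_const z
      exact (h1.fun_inv h0).fun_neg.congr_deriv (by rw [neg_div, neg_neg])
  rw [← hint]
  exact key.2

theorem eq_of_deriv_eq_zero_of_isPreconnected {I : ℂ → ℂ} {C S : Set ℂ} (hC : IsClosed C)
    (hI : ∀ z ∉ C, HasDerivAt I 0 z) (hS : IsPreconnected S) (hd : Disjoint S C) {x y : ℂ}
    (hx : x ∈ S) (hy : y ∈ S) : I x = I y := by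
  have hsub : S ⊆ connectedComponentIn Cᶜ x :=
    hS.subset_connectedComponentIn hx (disjoint_left.1 hd)
  have hsub' := connectedComponentIn_subset Cᶜ x
  exact hC.isOpen_compl.connectedComponentIn.is_const_of_deriv_eq_zero
    isPreconnected_connectedComponentIn
    (fun z hz => (hI z (hsub' hz)).differentiableAt.differentiableWithinAt)
    (fun z hz => (hI z (hsub' hz)).deriv) (hsub hx) (hsub hy)

/-- A lower bound for the denominator of the kernel in `tendsto_arcIntegral_jump`. -/
theorem exists_kernel_bound {F : ℝ → ℂ} (hF : Continuous F) (h0 : F 0 = 0)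
    (h1 : HasDerivAt F 1 0) {A B : ℝ} (hne : ∀ u ∈ Icc A B, u ≠ 0 → F u ≠ 0) :
    ∃ c > (0 : ℝ), ∃ ε₀ > (0 : ℝ), ∀ ε : ℝ, 0 < ε → ε < ε₀ → ∀ u ∈ Icc A B,
      c * (u ^ 2 + ε ^ 2) ≤ ‖F u ^ 2 + (ε : ℂ) ^ 2‖ := by
  have hlin : ∀ᶠ u in 𝓝 (0 : ℝ), ‖F u - u‖ ≤ 1 / 4 * ‖u‖ := by
    have := (hasDerivAt_iff_isLittleO.1 h1).def (show (0 : ℝ) < 1 / 4 by norm_num)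
    simpa [h0] using this
  obtain ⟨δ, hδ, hδ'⟩ := Metric.eventually_nhds_iff.1 hlin
  set C := Icc A B ∩ {u | δ ≤ |u|} with hCdef
  have hC : IsCompact C :=
    isCompact_Icc.inter_right (isClosed_le continuous_const continuous_abs)
  have hη : ∃ η > 0, ∀ u ∈ C, η ≤ ‖F u‖ := by
    rcases C.eq_empty_or_nonempty with h | h
    · exact ⟨1, one_pos, by simp [h]⟩
    · obtain ⟨x, hx, hmin⟩ := hC.exists_isMinOn h hF.norm.continuousOn
      refine ⟨‖F x‖, norm_pos_iff.2 (hne x hx.1 ?_), fun u hu => hmin hu⟩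
      rintro rfl
      have := hx.2
      simp at this
      linarith
  obtain ⟨η, hη, hη'⟩ := hη
  set M := max |A| |B| with hM
  have hM0 : 0 ≤ M := le_max_of_le_left (abs_nonneg _)
  have hMu : ∀ u ∈ Icc A B, u ^ 2 ≤ M ^ 2 := fun u hu =>
    sq_le_sq.2 ((abs_le_max_abs_abs hu.1 hu.2).trans (le_abs_self _))
  have hsum : ∀ ε : ℝ, ‖((ε : ℂ)) ^ 2‖ = ε ^ 2 := fun ε => by
    rw [norm_pow, Complex.norm_real, Real.norm_eq_abs, sq_abs]
  set c₁ := η ^ 2 / 2 / (M ^ 2 + η ^ 2) with hc₁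
  have hc₁0 : 0 < c₁ := by positivity
  -- Near `0`, `F ^ 2` differs from `u ^ 2` by at most `9 / 16 * u ^ 2`, which leaves `7 / 16`. Away
  -- from `0`, `η ≤ ‖F u‖` and `ε < η / 2` keep the norm above `η ^ 2 / 2`, and `c₁` turns this into
  -- a multiple of `M ^ 2 + η ^ 2`.
  refine ⟨min (7 / 16) c₁, lt_min (by norm_num) hc₁0, η / 2, by positivity, fun ε hε hε' u hu => ?_⟩
  rcases lt_or_ge |u| δ with hu' | hu'
  · have h2 : ‖F u - u‖ ≤ 1 / 4 * |u| := hδ' (by simpa using hu')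
    have h3 : ‖F u ^ 2 - (u : ℂ) ^ 2‖ ≤ 9 / 16 * u ^ 2 := by
      have : F u ^ 2 - (u : ℂ) ^ 2 = (F u - u) * ((F u - u) + 2 * u) := by ring
      rw [this, norm_mul]
      have h4 : ‖(F u - u) + 2 * (u : ℂ)‖ ≤ 9 / 4 * |u| := by
        refine (norm_add_le _ _).trans ?_
        rw [norm_mul, Complex.norm_real, Real.norm_eq_abs]
        simp only [Complex.norm_ofNat]
        linarith
      calc _ ≤ 1 / 4 * |u| * (9 / 4 * |u|) := by gcongr
        _ = 9 / 16 * |u| ^ 2 := by ring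
        _ = _ := by rw [sq_abs]
    have h5 : ‖((u ^ 2 + ε ^ 2 : ℝ) : ℂ)‖ = u ^ 2 + ε ^ 2 := by
      rw [Complex.norm_real, Real.norm_eq_abs, abs_of_nonneg (by positivity)]
    have h6 : ‖((u ^ 2 + ε ^ 2 : ℝ) : ℂ)‖ - ‖F u ^ 2 - (u : ℂ) ^ 2‖ ≤ ‖F u ^ 2 + (ε : ℂ) ^ 2‖ := by
      have h7 : F u ^ 2 + (ε : ℂ) ^ 2 =
        ((u ^ 2 + ε ^ 2 : ℝ) : ℂ) + (F u ^ 2 - (u : ℂ) ^ 2) := by push_cast; ring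
      rw [h7]
      exact norm_sub_le_norm_add _ _
    calc min (7 / 16) c₁ * (u ^ 2 + ε ^ 2) ≤ 7 / 16 * (u ^ 2 + ε ^ 2) := by
          gcongr; exact min_le_left _ _
      _ ≤ _ := by nlinarith [sq_nonneg ε]
  · have h2 := hη' u ⟨hu, hu'⟩
    have h3 : ‖F u ^ 2‖ - ‖((ε : ℂ)) ^ 2‖ ≤ ‖F u ^ 2 + (ε : ℂ) ^ 2‖ := norm_sub_le_norm_add _ _
    rw [hsum, norm_pow] at h3
    have h4 : η ^ 2 ≤ ‖F u‖ ^ 2 := by gcongr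
    have h5 : ε ^ 2 ≤ η ^ 2 / 4 := by nlinarith
    calc min (7 / 16) c₁ * (u ^ 2 + ε ^ 2) ≤ c₁ * (M ^ 2 + η ^ 2) := by
          refine mul_le_mul (min_le_right _ _) ?_ (by positivity) hc₁0.le
          linarith [hMu u hu, sq_nonneg η]
      _ = η ^ 2 / 2 := by rw [hc₁]; field_simp
      _ ≤ _ := by linarith [sq_nonneg η]

/-- The integrand is a perturbed Poisson kernel. After the substitution `u = ε * v` it tends
pointwise to `2 * I / (1 + v ^ 2)`, whose integral is `2πi`, and `exists_kernel_bound` supplies the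
dominating function. -/
theorem tendsto_kernel_integral {F F' : ℝ → ℂ} (hF : Continuous F) (hF' : Continuous F')
    (h0 : F 0 = 0) (h1 : HasDerivAt F 1 0) (h1' : F' 0 = 1) {A B : ℝ} (hA : A < 0) (hB : 0 < B)
    (hne : ∀ u ∈ Icc A B, u ≠ 0 → F u ≠ 0) :
    Tendsto (fun ε : ℝ => ∫ u in A..B, F' u * (2 * Complex.I * ε) / (F u ^ 2 + (ε : ℂ) ^ 2))
      (𝓝[>] 0) (𝓝 (2 * Real.pi * Complex.I)) := by
  obtain ⟨c, hc, ε₀, hε₀, hbd⟩ := exists_kernel_bound hF h0 h1 hne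
  obtain ⟨M, hM⟩ := isCompact_Icc.exists_bound_of_continuousOn (s := Icc A B) hF'.continuousOn
  have hM0 : 0 ≤ M := (norm_nonneg _).trans (hM 0 ⟨hA.le, hB.le⟩)
  set Φ : ℝ → ℝ → ℂ := fun ε => (Ioc A B).indicator
    (fun u => F' u * (2 * Complex.I * ε) / (F u ^ 2 + (ε : ℂ) ^ 2)) with hΦ
  have hscale : ∀ ε > (0 : ℝ), ∫ u in A..B, F' u * (2 * Complex.I * ε) / (F u ^ 2 + (ε : ℂ) ^ 2) =
      ∫ v, ε • Φ ε (ε * v) := by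
    intro ε hε
    rw [integral_smul, Measure.integral_comp_mul_left, smul_smul, abs_of_pos (inv_pos.2 hε),
      mul_inv_cancel₀ hε.ne', one_smul, hΦ, integral_indicator measurableSet_Ioc,
      intervalIntegral.integral_of_le (by linarith)]
  have hlim : ∫ v : ℝ, (2 * Complex.I) * (((1 + v ^ 2)⁻¹ : ℝ) : ℂ) = 2 * Real.pi * Complex.I := by
    rw [integral_const_mul, integral_complex_ofReal, integral_univ_inv_one_add_sq]
    ring
  rw [← hlim]
  have hmain : Tendsto (fun ε : ℝ => ∫ v, ε • Φ ε (ε * v)) (𝓝[>] 0)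
      (𝓝 (∫ v : ℝ, (2 * Complex.I) * (((1 + v ^ 2)⁻¹ : ℝ) : ℂ))) := by
    apply tendsto_integral_filter_of_dominated_convergence
      (fun v => 2 * M / c * (1 + v ^ 2)⁻¹)
    · refine Eventually.of_forall fun ε => ?_
      apply Measurable.aestronglyMeasurable
      refine Measurable.const_smul (Measurable.comp (g := Φ ε) ?_ (measurable_const_mul ε)) ε
      apply Measurable.indicator _ measurableSet_Ioc
      have := hF.measurable
      have := hF'.measurable
      fun_prop
    · filter_upwards [Ioo_mem_nhdsGT hε₀] with ε hε
      refine Eventually.of_forall fun v => ?_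
      simp only [hΦ, indicator]
      split_ifs with hv
      · have hv' := Ioc_subset_Icc_self hv
        have hb := hbd ε hε.1 hε.2 _ hv'
        have hε1 := hε.1
        have hpos : 0 < c * ((ε * v) ^ 2 + ε ^ 2) := by positivity
        rw [norm_smul, norm_div, norm_mul, norm_mul, norm_mul, Complex.norm_I, Complex.norm_real,
          Real.norm_eq_abs, abs_of_pos hε1, Complex.norm_ofNat]
        calc ε * (‖F' (ε * v)‖ * (2 * 1 * ε) / ‖F (ε * v) ^ 2 + (ε : ℂ) ^ 2‖)
            ≤ ε * (M * (2 * 1 * ε) / (c * ((ε * v) ^ 2 + ε ^ 2))) := by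
              gcongr
              exact hM _ hv'
          _ = 2 * M / c * (1 + v ^ 2)⁻¹ := by
              have : (0 : ℝ) < 1 + v ^ 2 := by positivity
              have h' : (ε * v) ^ 2 + ε ^ 2 = ε ^ 2 * (1 + v ^ 2) := by ring
              rw [h']
              field_simp
      · rw [smul_zero, norm_zero]; positivity
    · exact integrable_inv_one_add_sq.const_mul _
    · refine Eventually.of_forall fun v => ?_
      have hev : ∀ᶠ ε in 𝓝[>] (0 : ℝ), ε * v ∈ Ioc A B ∧ 0 < ε := by
        have ht : Tendsto (fun ε : ℝ => ε * v) (𝓝[>] 0) (𝓝 0) := by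
          have : Tendsto (fun ε : ℝ => ε * v) (𝓝 0) (𝓝 (0 * v)) :=
            (continuous_id.mul continuous_const).tendsto 0
          rw [zero_mul] at this
          exact this.mono_left nhdsWithin_le_nhds
        exact (ht.eventually (Ioc_mem_nhds hA hB)).and self_mem_nhdsWithin
      have hq : Tendsto (fun ε : ℝ => F (ε * v) / (ε : ℂ)) (𝓝[>] 0) (𝓝 (v : ℂ)) := by
        have hd : HasDerivAt (fun ε : ℝ => F (ε * v)) (v : ℂ) 0 := by
          have h1'' : HasDerivAt F 1 (0 * v) := by rwa [zero_mul]
          have := HasDerivAt.scomp (0 : ℝ) h1'' ((hasDerivAt_id (0 : ℝ)).mul_const v)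
          simp only [id_eq, one_mul, Complex.real_smul, mul_one] at this
          exact this
        have := hd.tendsto_slope_zero_right
        refine this.congr fun ε => ?_
        simp [h0, Complex.real_smul, div_eq_inv_mul]
      have hF'lim : Tendsto (fun ε : ℝ => F' (ε * v)) (𝓝[>] 0) (𝓝 1) := by
        have : Tendsto (fun ε : ℝ => F' (ε * v)) (𝓝 0) (𝓝 (F' (0 * v))) :=
          (hF'.comp (continuous_id.mul continuous_const)).tendsto 0
        rw [zero_mul, h1'] at this
        exact this.mono_left nhdsWithin_le_nhds
      have hv1 : (v : ℂ) ^ 2 + 1 ≠ 0 := by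
        have : (0 : ℝ) < v ^ 2 + 1 := by positivity
        exact_mod_cast this.ne'
      have hcomb := (hF'lim.mul_const (2 * Complex.I)).div ((hq.pow 2).add_const 1) hv1
      have heq : 1 * (2 * Complex.I) / ((v : ℂ) ^ 2 + 1) =
          (2 * Complex.I) * (((1 + v ^ 2)⁻¹ : ℝ) : ℂ) := by
        push_cast
        rw [add_comm]
        ring
      rw [heq] at hcomb
      refine hcomb.congr' ?_
      filter_upwards [hev] with ε hε
      simp only [hΦ, Pi.div_apply]
      rw [indicator_of_mem hε.1, Complex.real_smul]
      have hε' : (ε : ℂ) ≠ 0 := by exact_mod_cast hε.2.ne'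
      have hden : (F (ε * v) / (ε : ℂ)) ^ 2 + 1 =
          (F (ε * v) ^ 2 + (ε : ℂ) ^ 2) / (ε : ℂ) ^ 2 := by
        field_simp
      rw [hden, div_div_eq_mul_div]
      ring
  refine hmain.congr' ?_
  filter_upwards [self_mem_nhdsWithin] with ε hε
  exact (hscale ε hε).symm

/-- The jump of the Cauchy integral across an arc. -/
theorem tendsto_arcIntegral_jump {f : ℝ → ℂ} (hf : ContDiff ℝ ∞ f) {a b x : ℝ} (hax : a < x)
    (hxb : x < b) (hreg : deriv f x ≠ 0) (hne : ∀ u ∈ Icc a b, u ≠ x → f u ≠ f x) :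
    Tendsto (fun ε : ℝ => arcIntegral f a b (f x + ε * (Complex.I * deriv f x)) -
      arcIntegral f a b (f x - ε * (Complex.I * deriv f x))) (𝓝[>] 0)
      (𝓝 (2 * Real.pi * Complex.I)) := by
  have hc := hf.continuous
  have hc' := (contDiff_deriv hf).continuous
  set T := deriv f x with hT
  -- In this normalization the point is `0` and the tangent is `1`. The two Cauchy kernels at `± ε *
  -- I` then differ by `2 * I * ε * F' / (F ^ 2 + ε ^ 2)`.
  set F : ℝ → ℂ := fun u => (f (x + u) - f x) / T with hF
  set F' : ℝ → ℂ := fun u => deriv f (x + u) / T with hF'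
  have hFd : HasDerivAt F 1 0 := by
    have h1 : HasDerivAt f T (x + 0) := by
      rw [add_zero]; exact ((hf.differentiable (by simp)) x).hasDerivAt
    have := ((h1.comp_const_add x 0).sub_const (f x)).div_const T
    rwa [div_self hreg] at this
  have key := tendsto_kernel_integral (F := F) (F' := F') (A := a - x) (B := b - x)
    (by fun_prop) (by fun_prop) (by simp [hF]) hFd
    (by simp [hF', ← hT, div_self hreg]) (by linarith) (by linarith)
    (by
      intro u hu hu0
      apply div_ne_zero _ hreg
      apply sub_ne_zero.2 (hne _ ⟨by linarith [hu.1], by linarith [hu.2]⟩ (by simpa using hu0)))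
  obtain ⟨c, hc0, ε₀, hε₀, hbd⟩ := exists_kernel_bound (F := F) (A := a - x) (B := b - x)
    (by fun_prop) (by simp [hF]) hFd
    (by
      intro u hu hu0
      apply div_ne_zero _ hreg
      apply sub_ne_zero.2 (hne _ ⟨by linarith [hu.1], by linarith [hu.2]⟩ (by simpa using hu0)))
  refine key.congr' ?_
  filter_upwards [Ioo_mem_nhdsGT hε₀] with ε hε
  have hnz : ∀ u ∈ Icc (a - x) (b - x), F u ^ 2 + (ε : ℂ) ^ 2 ≠ 0 := by
    intro u hu h
    have := hbd ε hε.1 hε.2 u hu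
    rw [h, norm_zero] at this
    have hε1 := hε.1
    have : 0 < c * (u ^ 2 + ε ^ 2) := by positivity
    linarith
  have hfac : ∀ u, (F u ^ 2 + (ε : ℂ) ^ 2) = (F u - ε * Complex.I) * (F u + ε * Complex.I) := by
    intro u
    linear_combination ((ε : ℂ) ^ 2) * Complex.I_sq
  have hab : a - x ≤ b - x := by linarith
  have hm : ∀ u ∈ Icc (a - x) (b - x), F u - ε * Complex.I ≠ 0 := fun u hu h =>
    hnz u hu (by rw [hfac, h, zero_mul])
  have hp : ∀ u ∈ Icc (a - x) (b - x), F u + ε * Complex.I ≠ 0 := fun u hu h =>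
    hnz u hu (by rw [hfac, h, mul_zero])
  have hshift : ∀ z, arcIntegral f a b z = ∫ u in (a - x)..(b - x), deriv f (x + u) / (f (x + u) - z) := by
    intro z
    rw [intervalIntegral.integral_comp_add_left (fun u => deriv f u / (f u - z)) x]
    simp [arcIntegral]
  rw [hshift, hshift, ← intervalIntegral.integral_sub]
  · apply intervalIntegral.integral_congr
    intro u hu
    rw [uIcc_of_le hab] at hu
    have h1 := hm u hu
    have h2 := hp u hu
    have e1 : f (x + u) - (f x + ε * (Complex.I * T)) = T * (F u - ε * Complex.I) := by
      simp only [hF]; field_simp; ring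
    have e2 : f (x + u) - (f x - ε * (Complex.I * T)) = T * (F u + ε * Complex.I) := by
      simp only [hF]; field_simp; ring
    have e3 : deriv f (x + u) = T * F' u := by simp only [hF']; field_simp
    simp only
    rw [e1, e2, e3, hfac, mul_div_mul_left _ _ hreg, mul_div_mul_left _ _ hreg,
      div_sub_div _ _ h1 h2]
    congr 1
    ring
  · apply ContinuousOn.intervalIntegrable
    rw [uIcc_of_le hab]
    refine ContinuousOn.div (by fun_prop) (by fun_prop) fun u hu => ?_
    have e1 : f (x + u) - (f x + ε * (Complex.I * T)) = T * (F u - ε * Complex.I) := by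
      simp only [hF]; field_simp; ring
    rw [e1]
    exact mul_ne_zero hreg (hm u hu)
  · apply ContinuousOn.intervalIntegrable
    rw [uIcc_of_le hab]
    refine ContinuousOn.div (by fun_prop) (by fun_prop) fun u hu => ?_
    have e2 : f (x + u) - (f x - ε * (Complex.I * T)) = T * (F u + ε * Complex.I) := by
      simp only [hF]; field_simp; ring
    rw [e2]
    exact mul_ne_zero hreg (hp u hu)

/-! ### Tangent discs and the two sides of the curve -/

/-- The open generalized disc with parameter `c`, tangent to `g` at `g t` from the left. -/
def disc (g : ℝ → ℂ) (t c : ℝ) : Set ℂ := {z | z ≠ g t ∧ c < -(deriv g t / (z - g t)).im}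

/-- The union of the small tangent discs on the left of the curve. -/
def leftSide (g : ℝ → ℂ) (K : ℝ) : Set ℂ := {z | ∃ t, K < -(deriv g t / (z - g t)).im}

/-- The union of the small tangent discs on the right of the curve. -/
def rightSide (g : ℝ → ℂ) (K : ℝ) : Set ℂ := {z | ∃ t, K < (deriv g t / (z - g t)).im}

/-- The point `w = 0` corresponds to `z = ∞`, so it has to be removed for discs that contain a
neighbourhood of infinity. The rest is a union of overlapping convex pieces. -/
theorem isPreconnected_halfPlane_diff_zero (a : ℝ) : IsPreconnected {w : ℂ | w.im < a ∧ w ≠ 0} := by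
  rcases le_or_gt a 0 with ha | ha
  · have : {w : ℂ | w.im < a ∧ w ≠ 0} = {w | w.im < a} := by
      ext w
      refine ⟨fun h => h.1, fun h => ⟨h, ?_⟩⟩
      rintro rfl
      simp only [mem_ofPred_eq, Complex.zero_im] at h
      linarith
    rw [this]
    exact (convex_halfSpace_im_lt a).isPreconnected
  · have h1 : IsPreconnected {w : ℂ | w.im < 0} := (convex_halfSpace_im_lt 0).isPreconnected
    have h2 : IsPreconnected ({w : ℂ | 0 < w.re} ∩ {w | w.im < a}) :=
      ((convex_halfSpace_re_gt 0).inter (convex_halfSpace_im_lt a)).isPreconnected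
    have h3 : IsPreconnected ({w : ℂ | w.re < 0} ∩ {w | w.im < a}) :=
      ((convex_halfSpace_re_lt 0).inter (convex_halfSpace_im_lt a)).isPreconnected
    have h4 : IsPreconnected ({w : ℂ | 0 < w.im} ∩ {w | w.im < a}) :=
      ((convex_halfSpace_im_gt 0).inter (convex_halfSpace_im_lt a)).isPreconnected
    have h12 := h1.union' (by exact ⟨⟨1, -1⟩, by simp, by simp; linarith⟩) h2
    have h123 := h12.union' (by exact ⟨⟨-1, -1⟩, by simp, by simp; linarith⟩) h3
    have h1234 := h123.union' (by exact ⟨⟨1, a / 2⟩, by simp [ha], by simp [ha]⟩) h4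
    convert h1234 using 1
    ext w
    simp only [mem_ofPred_eq, mem_union, mem_inter_iff, ne_eq, Complex.ext_iff, Complex.zero_re,
      Complex.zero_im]
    constructor
    · rintro ⟨h, h'⟩
      rcases lt_trichotomy w.re 0 with h5 | h5 | h5
      · tauto
      · rcases lt_trichotomy w.im 0 with h6 | h6 | h6 <;> tauto
      · tauto
    · rintro (((h | h) | h) | h)
      · exact ⟨by linarith, fun h' => by linarith [h'.2]⟩
      · exact ⟨h.2, fun h' => by linarith [h'.1]⟩
      · exact ⟨h.2, fun h' => by linarith [h'.1]⟩
      · exact ⟨h.2, fun h' => by linarith [h'.2]⟩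

theorem add_div_sub_cancel {p T w : ℂ} (hT : T ≠ 0) : T / (p + T / w - p) = w := by
  rw [add_sub_cancel_left, div_div_cancel₀ hT]

theorem disc_eq_image {g : ℝ → ℂ} {t : ℝ} (hT : deriv g t ≠ 0) (c : ℝ) :
    disc g t c = (fun w => g t + deriv g t / w) '' {w : ℂ | w.im < -c ∧ w ≠ 0} := by
  ext z
  constructor
  · rintro ⟨hz, h⟩
    have hz' : z - g t ≠ 0 := sub_ne_zero.2 hz
    refine ⟨deriv g t / (z - g t), ⟨by linarith, div_ne_zero hT hz'⟩, ?_⟩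
    simp only
    rw [div_div_cancel₀ hT]
    ring
  · rintro ⟨w, ⟨hw, hw0⟩, rfl⟩
    refine ⟨?_, ?_⟩
    · simp [hT, hw0]
    · simp only
      rw [add_div_sub_cancel hT]
      linarith

theorem isPreconnected_disc {g : ℝ → ℂ} {t : ℝ} (hT : deriv g t ≠ 0) (c : ℝ) :
    IsPreconnected (disc g t c) := by
  rw [disc_eq_image hT]
  refine (isPreconnected_halfPlane_diff_zero _).image _ ?_
  refine ContinuousOn.add continuousOn_const (continuousOn_const.div continuousOn_id ?_)
  exact fun w hw => hw.2

theorem Supp.disjoint_disc {g : ℝ → ℂ} {t c : ℝ} (h : Supp g t c) :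
    Disjoint (disc g t c) (range g) := by
  rw [disjoint_left]
  rintro _ ⟨h1, h2⟩ ⟨r, rfl⟩
  have := h r h1
  rw [lam] at this
  linarith

/-- On the left normal `Im w` tends to `-∞` at the point of tangency. Points close to the curve on
that normal therefore lie in every left tangent disc. -/
theorem left_point_im {T p : ℂ} (hT : T ≠ 0) (ε : ℝ) :
    (T / (p + ε * (Complex.I * T) - p)).im = -ε⁻¹ := by
  have : T / (p + ε * (Complex.I * T) - p) = ((-ε⁻¹ : ℝ) : ℂ) * Complex.I := by
    rw [add_sub_cancel_left]
    push_cast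
    rcases eq_or_ne ε 0 with rfl | h
    · simp
    · have : (ε : ℂ) ≠ 0 := by exact_mod_cast h
      field_simp
      simp
  rw [this, Complex.im_ofReal_mul, Complex.I_im, mul_one]

theorem right_point_im {T p : ℂ} (hT : T ≠ 0) (ε : ℝ) :
    (T / (p - ε * (Complex.I * T) - p)).im = ε⁻¹ := by
  have := left_point_im (p := p) hT (-ε)
  rw [inv_neg, neg_neg] at this
  rw [← this]
  push_cast
  ring_nf

theorem eventually_left_mem_disc {g : ℝ → ℂ} {t : ℝ} (hT : deriv g t ≠ 0) (c : ℝ) :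
    ∀ᶠ ε : ℝ in 𝓝[>] 0, g t + ε * (Complex.I * deriv g t) ∈ disc g t c := by
  filter_upwards [self_mem_nhdsWithin, tendsto_inv_nhdsGT_zero.eventually_gt_atTop c] with ε h0 h
  refine ⟨?_, ?_⟩
  · have : (ε : ℂ) ≠ 0 := by exact_mod_cast (ne_of_gt h0)
    simp [hT, this]
  · rwa [left_point_im hT, neg_neg]

theorem eventually_mem_leftSide {g : ℝ → ℂ} {t : ℝ} (hT : deriv g t ≠ 0) (K : ℝ) :
    ∀ᶠ ε : ℝ in 𝓝[>] 0, g t + ε * (Complex.I * deriv g t) ∈ leftSide g K := by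
  filter_upwards [eventually_left_mem_disc hT K] with ε h
  exact ⟨t, h.2⟩

theorem eventually_mem_rightSide {g : ℝ → ℂ} {t : ℝ} (hT : deriv g t ≠ 0) (K : ℝ) :
    ∀ᶠ ε : ℝ in 𝓝[>] 0, g t - ε * (Complex.I * deriv g t) ∈ rightSide g K := by
  filter_upwards [tendsto_inv_nhdsGT_zero.eventually_gt_atTop K] with ε h
  exact ⟨t, by rwa [right_point_im hT]⟩

theorem isOpen_rightSide {g : ℝ → ℂ} {K : ℝ} (hK : 0 < K) : IsOpen (rightSide g K) := by
  have : rightSide g K = ⋃ t, {z | K < (deriv g t / (z - g t)).im} := by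
    ext z; simp [rightSide]
  rw [this]
  refine isOpen_iUnion fun t => ?_
  rw [isOpen_iff_mem_nhds]
  intro z hz
  have hne : z - g t ≠ 0 := by
    intro h
    simp only [mem_ofPred_eq, h, div_zero, Complex.zero_im] at hz
    linarith
  have : ContinuousAt (fun z => (deriv g t / (z - g t)).im) z :=
    Complex.continuous_im.continuousAt.comp
      (continuousAt_const.div (continuousAt_id.sub continuousAt_const) hne)
  exact this.eventually_const_lt hz

namespace IsJordan

variable {g : ℝ → ℂ} {L : ℝ}

theorem isPreconnected_leftSide (hg : IsJordan g L) {K : ℝ} (hK : 0 < K) :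
    IsPreconnected (leftSide g K) := by
  have h1 : leftSide g K = (fun p : ℝ × ℂ => g p.1 + deriv g p.1 / p.2) ''
      (univ ×ˢ {w : ℂ | w.im < -K}) := by
    ext z
    constructor
    · rintro ⟨t, ht⟩
      refine ⟨(t, deriv g t / (z - g t)), ⟨mem_univ _, ?_⟩, ?_⟩
      · simp only [mem_ofPred_eq]; linarith
      · simp only
        rw [div_div_cancel₀ (hg.regular t)]
        ring
    · rintro ⟨⟨t, w⟩, ⟨-, hw⟩, rfl⟩
      refine ⟨t, ?_⟩
      simp only [mem_ofPred_eq] at hw ⊢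
      rw [add_div_sub_cancel (hg.regular t)]
      linarith
  rw [h1]
  refine (isPreconnected_univ.prod (convex_halfSpace_im_lt _).isPreconnected).image _ ?_
  have hc := hg.smooth.continuous
  have hc' := hg.continuous_deriv
  refine ContinuousOn.add (by fun_prop) (ContinuousOn.div (by fun_prop) (by fun_prop) ?_)
  rintro ⟨t, w⟩ ⟨-, hw⟩ h0
  simp only [mem_ofPred_eq] at hw h0
  rw [h0, Complex.zero_im] at hw
  linarith

theorem isPreconnected_rightSide (hg : IsJordan g L) {K : ℝ} (hK : 0 < K) :
    IsPreconnected (rightSide g K) := by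
  have h1 : rightSide g K = (fun p : ℝ × ℂ => g p.1 + deriv g p.1 / p.2) ''
      (univ ×ˢ {w : ℂ | K < w.im}) := by
    ext z
    constructor
    · rintro ⟨t, ht⟩
      refine ⟨(t, deriv g t / (z - g t)), ⟨mem_univ _, ht⟩, ?_⟩
      simp only
      rw [div_div_cancel₀ (hg.regular t)]
      ring
    · rintro ⟨⟨t, w⟩, ⟨-, hw⟩, rfl⟩
      refine ⟨t, ?_⟩
      simp only [mem_ofPred_eq] at hw ⊢
      rwa [add_div_sub_cancel (hg.regular t)]
  rw [h1]
  refine (isPreconnected_univ.prod (convex_halfSpace_im_gt _).isPreconnected).image _ ?_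
  have hc := hg.smooth.continuous
  have hc' := hg.continuous_deriv
  refine ContinuousOn.add (by fun_prop) (ContinuousOn.div (by fun_prop) (by fun_prop) ?_)
  rintro ⟨t, w⟩ ⟨-, hw⟩ h0
  simp only [mem_ofPred_eq] at hw h0
  rw [h0, Complex.zero_im] at hw
  linarith

theorem isClosed_range (hg : IsJordan g L) : IsClosed (range g) := by
  rw [← hg.periodic.image_Icc hg.pos 0]
  exact (isCompact_Icc.image hg.smooth.continuous).isClosed

theorem arc_ne (hg : IsJordan g L) {a b x : ℝ} (hax : a < x) (hxb : x < b) (h : b - a ≤ L) :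
    ∀ u ∈ Icc a b, u ≠ x → g u ≠ g x := fun u hu hux => by
  apply hg.ne_of_abs_lt hux
  rw [abs_lt]
  constructor <;> linarith [hu.1, hu.2]

end IsJordan

/-! ### Separation of the two sides -/

/-- A bound on the curvature of the circles tangent to the curve at one point and meeting it at
another one. -/
structure IsCurvBound (g : ℝ → ℂ) (K : ℝ) : Prop where
  pos : 0 < K
  abs_lam_lt : ∀ t s, |lam g t s| < K

namespace IsCurvBound

variable {g : ℝ → ℂ} {L K : ℝ}

theorem disjoint_leftSide (hK : IsCurvBound g K) : Disjoint (leftSide g K) (range g) := by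
  rw [disjoint_left]
  rintro _ ⟨t, ht⟩ ⟨r, rfl⟩
  have := (abs_lt.1 (hK.abs_lam_lt t r)).2
  rw [lam] at this
  linarith

theorem disjoint_rightSide (hK : IsCurvBound g K) : Disjoint (rightSide g K) (range g) := by
  rw [disjoint_left]
  rintro _ ⟨t, ht⟩ ⟨r, rfl⟩
  have := (abs_lt.1 (hK.abs_lam_lt t r)).1
  rw [lam] at this
  linarith

/-- The curve separates its left side from its right side. -/
theorem separation (hK : IsCurvBound g K) (hg : IsJordan g L) {S : Set ℂ} (hS : IsPreconnected S)
    (hd : Disjoint S (range g)) (hl : (S ∩ leftSide g K).Nonempty)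
    (hr : (S ∩ rightSide g K).Nonempty) : False := by
  have hL := hg.pos
  set S' := S ∪ leftSide g K ∪ rightSide g K with hS'
  have hconn : IsPreconnected S' := by
    refine (hS.union' hl (hg.isPreconnected_leftSide hK.pos)).union' ?_
      (hg.isPreconnected_rightSide hK.pos)
    obtain ⟨z, h1, h2⟩ := hr
    exact ⟨z, Or.inl h1, h2⟩
  have hdisj : Disjoint S' (range g) := by
    rw [hS', disjoint_union_left, disjoint_union_left]
    exact ⟨⟨hd, hK.disjoint_leftSide⟩, hK.disjoint_rightSide⟩
  have hper : g (-(L / 2)) = g (L / 2) := by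
    rw [← hg.periodic]; congr 1; ring
  have himg : g '' Icc (-(L / 2)) (L / 2) ⊆ range g := image_subset_range _ _
  -- Since `g` closes up over one period, the integral is constant on the connected set `S'`. That
  -- set contains points on both sides of `g 0`, which contradicts the jump.
  have hjump := tendsto_arcIntegral_jump hg.smooth (a := -(L / 2)) (b := L / 2) (x := 0)
    (by linarith) (by linarith) (hg.regular 0)
    (hg.arc_ne (by linarith) (by linarith) (by linarith))
  have hzero : ∀ᶠ ε : ℝ in 𝓝[>] 0,
      arcIntegral g (-(L / 2)) (L / 2) (g 0 + ε * (Complex.I * deriv g 0)) -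
      arcIntegral g (-(L / 2)) (L / 2) (g 0 - ε * (Complex.I * deriv g 0)) = 0 := by
    filter_upwards [eventually_mem_leftSide (hg.regular 0) K,
      eventually_mem_rightSide (hg.regular 0) K] with ε h1 h2
    rw [sub_eq_zero]
    refine eq_of_deriv_eq_zero_of_isPreconnected hg.isClosed_range ?_ hconn hdisj
      (Or.inl (Or.inr h1)) (Or.inr h2)
    intro z hz
    have := hasDerivAt_arcIntegral hg.smooth (show -(L / 2) ≤ L / 2 by linarith)
      (fun h => hz (himg h))
    rwa [hper, sub_self] at this
  have := tendsto_nhds_unique (hjump.congr' hzero) tendsto_const_nhds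
  simp [Real.pi_ne_zero] at this

/-- An empty tangent disc is connected and contains points of the left side near its point of
tangency, so reaching the right side would violate `separation`. -/
theorem disjoint_disc_rightSide (hK : IsCurvBound g K) (hg : IsJordan g L) {t c : ℝ}
    (h : Supp g t c) : Disjoint (disc g t c) (rightSide g K) := by
  rw [disjoint_left]
  intro z hz hz'
  refine hK.separation hg (isPreconnected_disc (hg.regular t) c) h.disjoint_disc ?_ ⟨z, hz, hz'⟩
  obtain ⟨ε, h1, h2⟩ := ((eventually_left_mem_disc (hg.regular t) c).and
    (eventually_mem_leftSide (hg.regular t) K)).exists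
  exact ⟨_, h1, h2⟩

end IsCurvBound

/-! ### Incircles and interlaced contacts -/

/-- A disc lying on the left side of the curve and not meeting it. -/
structure IsIncircle (g : ℝ → ℂ) (K : ℝ) (c : ℂ) (r : ℝ) : Prop where
  pos : 0 < r
  disjoint : Disjoint (Metric.ball c r) (range g)
  disjoint_right : Disjoint (Metric.ball c r) (rightSide g K)

theorem IsIncircle.le_dist {g : ℝ → ℂ} {K : ℝ} {c : ℂ} {r : ℝ} (h : IsIncircle g K c r) (s : ℝ) :
    r ≤ dist (g s) c := by
  by_contra! h'
  exact disjoint_left.1 h.disjoint h' ⟨s, rfl⟩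

/-- The power of a point with respect to a tangent circle, in terms of `Im (T / ζ)`. It translates
between generalized discs and metric balls. -/
theorem norm_sub_sq_sub {T ζ : ℂ} (hζ : ζ ≠ 0) (y : ℝ) :
    ‖ζ - y * (Complex.I * T)‖ ^ 2 - (y * ‖T‖) ^ 2 = ‖ζ‖ ^ 2 * (1 + 2 * y * (T / ζ).im) := by
  have h0 : Complex.normSq ζ ≠ 0 := by simpa using hζ
  rw [mul_pow, Complex.sq_norm, Complex.sq_norm, Complex.sq_norm, Complex.div_im]
  field_simp
  simp only [Complex.normSq_apply, Complex.sub_re, Complex.sub_im, Complex.mul_re, Complex.mul_im,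
    Complex.I_re, Complex.I_im, Complex.ofReal_re, Complex.ofReal_im]
  ring

section tangent

variable {g : ℝ → ℂ} {t y : ℝ}

theorem dist_sq_sub {z : ℂ} (hz : z ≠ g t) :
    dist z (g t + y * (Complex.I * deriv g t)) ^ 2 - (y * ‖deriv g t‖) ^ 2 =
      ‖z - g t‖ ^ 2 * (1 + 2 * y * (deriv g t / (z - g t)).im) := by
  rw [← norm_sub_sq_sub (sub_ne_zero.2 hz), dist_eq_norm, sub_add_eq_sub_sub]

theorem mem_disc_iff_mem_ball (hy : 0 < y) (z : ℂ) :
    z ∈ disc g t (2 * y)⁻¹ ↔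
      z ∈ Metric.ball (g t + y * (Complex.I * deriv g t)) (y * ‖deriv g t‖) := by
  rcases eq_or_ne z (g t) with rfl | hz
  · simp [disc, abs_of_pos hy]
  have h := dist_sq_sub (y := y) hz
  have hpos : 0 < ‖z - g t‖ ^ 2 := by
    have := norm_pos_iff.2 (sub_ne_zero.2 hz)
    positivity
  rw [Metric.mem_ball, ← sq_lt_sq₀ dist_nonneg (by positivity), ← sub_neg, h]
  simp only [disc, mem_ofPred_eq, hz, ne_eq, not_false_iff, true_and]
  rw [mul_neg_iff, inv_lt_iff_one_lt_mul₀ (by positivity)]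
  simp only [hpos, hpos.not_gt, true_and, false_and, or_false]
  constructor <;> intro h' <;> linarith

theorem dist_eq_iff_lam (hy : 0 < y) {s : ℝ} (hs : g s ≠ g t) :
    dist (g s) (g t + y * (Complex.I * deriv g t)) = y * ‖deriv g t‖ ↔
      lam g t s = (2 * y)⁻¹ := by
  have h := dist_sq_sub (y := y) hs
  have hpos : 0 < ‖g s - g t‖ ^ 2 := by
    have := norm_pos_iff.2 (sub_ne_zero.2 hs)
    positivity
  rw [← sq_eq_sq₀ dist_nonneg (by positivity), ← sub_eq_zero, h, mul_eq_zero, lam,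
    ← one_div, eq_div_iff (by positivity)]
  simp only [hpos.ne', false_or]
  constructor <;> intro h' <;> linarith

theorem dist_self_center (hy : 0 < y) :
    dist (g t) (g t + y * (Complex.I * deriv g t)) = y * ‖deriv g t‖ := by
  simp [abs_of_pos hy]

end tangent

section

variable {g : ℝ → ℂ} {L K : ℝ}

theorem Supp.isIncircle (hK : IsCurvBound g K) (hg : IsJordan g L) {t y : ℝ} (hy : 0 < y)
    (h : Supp g t (2 * y)⁻¹) :
    IsIncircle g K (g t + y * (Complex.I * deriv g t)) (y * ‖deriv g t‖) := by
  have hball : Metric.ball (g t + y * (Complex.I * deriv g t)) (y * ‖deriv g t‖) =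
      disc g t (2 * y)⁻¹ := by
    ext z; rw [mem_disc_iff_mem_ball hy]
  refine ⟨mul_pos hy (norm_pos_iff.2 (hg.regular t)), ?_, ?_⟩
  · rw [hball]; exact h.disjoint_disc
  · rw [hball]; exact hK.disjoint_disc_rightSide hg h

/-- At a contact point the distance to the center is minimal, so the radius is normal to the curve.
The center lies on the left, since otherwise the ball would contain points of the right side. -/
theorem IsIncircle.exists_tangent (hg : IsJordan g L) {c : ℂ} {r : ℝ} (h : IsIncircle g K c r)
    {q : ℝ} (hq : dist (g q) c = r) :
    ∃ y > (0 : ℝ), c = g q + y * (Complex.I * deriv g q) ∧ r = y * ‖deriv g q‖ ∧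
      Supp g q (2 * y)⁻¹ := by
  have hT := hg.regular q
  have hmin : IsLocalMin (fun u => ‖g u - c‖ ^ 2) q := by
    refine Eventually.of_forall fun u => ?_
    have h1 := h.le_dist u
    rw [dist_eq_norm] at h1 hq
    simp only [hq]
    have := h.pos
    gcongr
  have hder : HasDerivAt (fun u => ‖g u - c‖ ^ 2) _ q :=
    ((hg.differentiable q).hasDerivAt.sub_const c).norm_sq
  have h0 := hmin.hasDerivAt_eq_zero hder
  set T := deriv g q with hTdef
  set v := c - g q with hv
  have h1 : (v / T).re = 0 := by
    rw [Complex.inner] at h0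
    have h2 : v.re * T.re + v.im * T.im = 0 := by
      simp only [Complex.mul_re, Complex.conj_re, Complex.conj_im, Complex.sub_re,
        Complex.sub_im, hv] at h0 ⊢
      linarith
    rw [Complex.div_re, ← add_div, h2, zero_div]
  set y := (v / T).im with hy
  have hvy : v = y * (Complex.I * T) := by
    have h3 : v / T = y * Complex.I := Complex.ext (by simp [h1]) (by simp [hy])
    rw [div_eq_iff hT] at h3
    rw [h3]; ring
  have hc : c = g q + y * (Complex.I * T) := by rw [← hvy, hv]; ring
  have hr : r = |y| * ‖T‖ := by
    rw [← hq, hc]; simp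
  have hTpos : 0 < ‖T‖ := norm_pos_iff.2 hT
  have hy0 : y ≠ 0 := by
    intro h0
    have := h.pos
    rw [hr, h0] at this
    simp at this
  have hypos : 0 < y := by
    by_contra! hneg
    have hneg' : y < 0 := lt_of_le_of_ne hneg hy0
    obtain ⟨ε, hε, hε1⟩ := ((eventually_mem_rightSide hT K).and
      (Ioo_mem_nhdsGT (show 0 < -y by linarith))).exists
    refine disjoint_left.1 h.disjoint_right ?_ hε
    rw [Metric.mem_ball, hc, hr, dist_eq_norm]
    have : g q - ε * (Complex.I * T) - (g q + y * (Complex.I * T)) =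
      ((-(ε + y) : ℝ) : ℂ) * (Complex.I * T) := by push_cast; ring
    rw [this, norm_mul, norm_mul, Complex.norm_I, one_mul, Complex.norm_real, Real.norm_eq_abs]
    refine mul_lt_mul_of_pos_right ?_ hTpos
    rw [abs_of_neg hneg', abs_of_pos (by linarith [hε1.2])]
    linarith [hε1.1]
  rw [abs_of_pos hypos] at hr
  refine ⟨y, hypos, hc, hr, fun s hs => ?_⟩
  by_contra! h4
  have h5 : g s ∈ disc g q (2 * y)⁻¹ := ⟨hs, h4⟩
  rw [mem_disc_iff_mem_ball hypos, ← hTdef, ← hc, ← hr] at h5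
  exact disjoint_left.1 h.disjoint h5 ⟨s, rfl⟩

/-- The difference of the powers of a point with respect to two circles is affine. -/
theorem dist_sq_sub_dist_sq_segment (c₁ c₂ A B : ℂ) (θ : ℝ) :
    dist (A + θ * (B - A)) c₁ ^ 2 - dist (A + θ * (B - A)) c₂ ^ 2 =
      (1 - θ) * (dist A c₁ ^ 2 - dist A c₂ ^ 2) + θ * (dist B c₁ ^ 2 - dist B c₂ ^ 2) := by
  simp only [dist_eq_norm, Complex.sq_norm, Complex.normSq_apply, Complex.sub_re, Complex.sub_im,
    Complex.add_re, Complex.add_im, Complex.mul_re, Complex.mul_im, Complex.ofReal_re,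
    Complex.ofReal_im]
  ring

theorem add_mul_sub_mem_openSegment (A B : ℂ) {θ : ℝ} (h : θ ∈ Ioo (0 : ℝ) 1) :
    A + θ * (B - A) ∈ openSegment ℝ A B := by
  refine ⟨1 - θ, θ, by linarith [h.2], h.1, by ring, ?_⟩
  simp only [Complex.real_smul]
  push_cast
  ring

/-- The integral of `dw / (w - z)` along the arc `g` on `[a, b]` closed up by its chord is locally
constant. -/
theorem hasDerivAt_arcIntegral_add_chord (hg : ContDiff ℝ ∞ g) {a b : ℝ} (hab : a ≤ b) {z : ℂ}
    (hz : z ∉ g '' Icc a b)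
    (hz' : z ∉ (fun u : ℝ => g b + u * (g a - g b)) '' Icc (0 : ℝ) 1) :
    HasDerivAt (fun z => arcIntegral g a b z +
      arcIntegral (fun u : ℝ => g b + u * (g a - g b)) 0 1 z) 0 z := by
  have hch : ContDiff ℝ ∞ (fun u : ℝ => g b + u * (g a - g b)) :=
    contDiff_const.add (Complex.ofRealCLM.contDiff.mul contDiff_const)
  refine ((hasDerivAt_arcIntegral hg hab hz).add
    (hasDerivAt_arcIntegral hch zero_le_one hz')).congr_deriv ?_
  simp

/-- Two incircles touching the curve at two interlaced pairs of points coincide at those points. -/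
theorem IsIncircle.dist_eq_of_interlaced (hK : IsCurvBound g K) (hg : IsJordan g L)
    {c₁ c₂ : ℂ} {r₁ r₂ : ℝ} (h₁ : IsIncircle g K c₁ r₁) (h₂ : IsIncircle g K c₂ r₂)
    {a p b q : ℝ} (hap : a < p) (hpb : p < b) (hbq : b < q) (hqa : q < a + L)
    (ha : dist (g a) c₁ = r₁) (hb : dist (g b) c₁ = r₁) (hp : dist (g p) c₂ = r₂)
    (hq : dist (g q) c₂ = r₂) : dist (g p) c₁ = r₁ := by
  by_contra hne
  have hp₁ : r₁ < dist (g p) c₁ := lt_of_le_of_ne (h₁.le_dist p) (Ne.symm hne)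
  have hpq : g p ≠ g q := hg.inj p q (by linarith) (by linarith)
  have hab : g a ≠ g b := hg.inj a b (by linarith) (by linarith)
  -- The chord closes the arc from `a` to `b` inside the first disc. The resulting loop should
  -- separate the two sides of the curve at `p`.
  set chord : ℝ → ℂ := fun u => g b + u * (g a - g b) with hchord
  have hchc : Continuous chord := by fun_prop
  have hchd : ContDiff ℝ ∞ chord :=
    contDiff_const.add (Complex.ofRealCLM.contDiff.mul contDiff_const)
  have hseg₁ : ∀ u ∈ Ioo (0 : ℝ) 1, chord u ∈ Metric.ball c₁ r₁ := fun u hu =>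
    openSegment_subset_ball_of_ne (Metric.mem_closedBall.2 hb.le)
      (Metric.mem_closedBall.2 ha.le) hab.symm (add_mul_sub_mem_openSegment _ _ hu)
  have hseg₂ : ∀ u ∈ Ioo (0 : ℝ) 1, g p + u * (g q - g p) ∈ Metric.ball c₂ r₂ := fun u hu =>
    openSegment_subset_ball_of_ne (Metric.mem_closedBall.2 hp.le)
      (Metric.mem_closedBall.2 hq.le) hpq (add_mul_sub_mem_openSegment _ _ hu)
  have hch : ∀ z ∈ chord '' Icc 0 1, z = g a ∨ z = g b ∨ ∃ u ∈ Ioo (0 : ℝ) 1, z = chord u := by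
    rintro _ ⟨u, hu, rfl⟩
    rcases hu.1.eq_or_lt with h0 | h0
    · right; left; simp [chord, ← h0]
    rcases hu.2.eq_or_lt with h1 | h1
    · left; simp [chord, h1]
    · exact Or.inr (Or.inr ⟨u, ⟨h0, h1⟩, rfl⟩)
  have hoff : ∀ z ∉ range g, (∀ u ∈ Ioo (0 : ℝ) 1, z ≠ chord u) →
      z ∉ g '' Icc a b ∪ chord '' Icc 0 1 := by
    rintro z hz hz' (⟨s, -, rfl⟩ | h)
    · exact hz ⟨s, rfl⟩
    · rcases hch z h with rfl | rfl | ⟨u, hu, rfl⟩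
      · exact hz ⟨a, rfl⟩
      · exact hz ⟨b, rfl⟩
      · exact hz' u hu rfl
  have hC : IsClosed (g '' Icc a b ∪ chord '' Icc 0 1) :=
    ((isCompact_Icc.image hg.smooth.continuous).isClosed).union
      (isCompact_Icc.image hchc).isClosed
  have hpch : g p ∉ chord '' Icc 0 1 := by
    intro h
    rcases hch _ h with h | h | ⟨u, hu, h⟩
    · exact hg.inj a p hap (by linarith) h.symm
    · exact hg.inj p b hpb (by linarith) h
    · exact disjoint_left.1 h₁.disjoint (hseg₁ u hu) ⟨p, h⟩
  obtain ⟨δ, hδ, hball⟩ := Metric.isOpen_iff.1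
    (isCompact_Icc.image hchc).isClosed.isOpen_compl _ hpch
  -- A path from the left of `p` to the right of `p` that avoids the loop: along the chord of the
  -- second disc to `g q`, then through the right side of the curve. The start `g p` lies on the
  -- loop, so the chord is taken without it and is joined to a piece of the second disc near `g p`.
  set half : Set ℂ := (fun u : ℝ => g p + u * (g q - g p)) '' Ioc 0 1 with hhalf
  have hhalf_conn : IsPreconnected half := isPreconnected_Ioc.image _ (by fun_prop)
  have hq_half : g q ∈ half := ⟨1, by simp, by simp⟩
  have hq_cl : g q ∈ closure (rightSide g K) := by
    refine mem_closure_of_tendsto (f := fun ε : ℝ => g q - ε * (Complex.I * deriv g q))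
      (b := 𝓝[>] (0 : ℝ)) ?_ (eventually_mem_rightSide (hg.regular q) K)
    have : Tendsto (fun ε : ℝ => g q - ε * (Complex.I * deriv g q)) (𝓝 0)
        (𝓝 (g q - (0 : ℝ) * (Complex.I * deriv g q))) := Continuous.tendsto (by fun_prop) 0
    simp only [Complex.ofReal_zero, zero_mul, sub_zero] at this
    exact this.mono_left nhdsWithin_le_nhds
  have hR' : IsPreconnected (insert (g q) (rightSide g K)) :=
    (hg.isPreconnected_rightSide hK.pos).subset_closure (subset_insert _ _)
      (insert_subset hq_cl subset_closure)
  have hRh : IsPreconnected (insert (g q) (rightSide g K) ∪ half) :=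
    hR'.union' ⟨g q, mem_insert _ _, hq_half⟩ hhalf_conn
  have hBB : IsPreconnected (Metric.ball c₂ r₂ ∩ Metric.ball (g p) δ) :=
    ((convex_ball _ _).inter (convex_ball _ _)).isPreconnected
  have hS : IsPreconnected (insert (g q) (rightSide g K) ∪ half ∪
      (Metric.ball c₂ r₂ ∩ Metric.ball (g p) δ)) := by
    refine hRh.union' ?_ hBB
    have h1 : Tendsto (fun u : ℝ => g p + u * (g q - g p)) (𝓝[>] 0) (𝓝 (g p)) := by
      have : Tendsto (fun u : ℝ => g p + u * (g q - g p)) (𝓝 0)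
        (𝓝 (g p + (0 : ℝ) * (g q - g p))) := Continuous.tendsto (by fun_prop) 0
      simp only [Complex.ofReal_zero, zero_mul, add_zero] at this
      exact this.mono_left nhdsWithin_le_nhds
    obtain ⟨u, hu, hu'⟩ := ((h1.eventually (Metric.ball_mem_nhds _ hδ)).and
      (Ioo_mem_nhdsGT (zero_lt_one' ℝ))).exists
    exact ⟨_, Or.inr ⟨u, ⟨hu'.1, hu'.2.le⟩, rfl⟩, hseg₂ u hu', hu⟩
  have hdisj : Disjoint (insert (g q) (rightSide g K) ∪ half ∪
      (Metric.ball c₂ r₂ ∩ Metric.ball (g p) δ)) (g '' Icc a b ∪ chord '' Icc 0 1) := by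
    have hqC : g q ∉ g '' Icc a b ∪ chord '' Icc 0 1 := by
      rintro (⟨u, hu, h⟩ | h)
      · exact hg.inj u q (by linarith [hu.2]) (by linarith [hu.1]) h
      · rcases hch _ h with h | h | ⟨u, hu, h⟩
        · exact hg.inj a q (by linarith) hqa h.symm
        · exact hg.inj b q (by linarith) (by linarith) h.symm
        · exact disjoint_left.1 h₁.disjoint (hseg₁ u hu) ⟨q, h⟩
    rw [disjoint_left]
    rintro z (((rfl | hz) | ⟨θ, hθ, rfl⟩) | ⟨hz, hz'⟩)
    · exact hqC
    · refine hoff z (disjoint_left.1 hK.disjoint_rightSide hz) ?_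
      rintro u hu rfl
      exact disjoint_left.1 h₁.disjoint_right (hseg₁ u hu) hz
    · rcases hθ.2.eq_or_lt with h1 | h1
      · simpa [h1] using hqC
      · refine hoff _ (disjoint_left.1 h₂.disjoint (hseg₂ θ ⟨hθ.1, h1⟩)) ?_
        intro u hu heq
        -- If the chords met, the difference of the two powers, which is affine, would take one
        -- value at a point of both. It is at most `r₁ ^ 2 - r₂ ^ 2` on the chord of the first disc.
        -- On that of the second it is larger, strictly so before `g q`, because `g p` is off the
        -- first circle.
        have e1 := dist_sq_sub_dist_sq_segment c₁ c₂ (g p) (g q) θ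
        have e2 := dist_sq_sub_dist_sq_segment c₁ c₂ (g b) (g a) u
        simp only [heq, hchord] at e1
        rw [e2, ha, hb, hp, hq] at e1
        have i1 : r₂ ^ 2 ≤ dist (g a) c₂ ^ 2 := by
          have := h₂.le_dist a; have := h₂.pos; gcongr
        have i2 : r₂ ^ 2 ≤ dist (g b) c₂ ^ 2 := by
          have := h₂.le_dist b; have := h₂.pos; gcongr
        have i3 : r₁ ^ 2 < dist (g p) c₁ ^ 2 := by
          have := h₁.pos; gcongr
        have i4 : r₁ ^ 2 ≤ dist (g q) c₁ ^ 2 := by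
          have := h₁.le_dist q; have := h₁.pos; gcongr
        have j1 := mul_nonneg hu.1.le (sub_nonneg.2 i1)
        have j2 := mul_nonneg (sub_nonneg.2 hu.2.le) (sub_nonneg.2 i2)
        have j3 := mul_pos (sub_pos.2 h1) (sub_pos.2 i3)
        have j4 := mul_nonneg hθ.1.le (sub_nonneg.2 i4)
        nlinarith
    · refine hoff z (disjoint_left.1 h₂.disjoint hz) ?_
      rintro u hu rfl
      exact hball hz' ⟨u, Ioo_subset_Icc_self hu, rfl⟩
  obtain ⟨y, hy, hc₂, hr₂, -⟩ := h₂.exists_tangent hg hp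
  have hjump := tendsto_arcIntegral_jump hg.smooth hap hpb (hg.regular p)
    (hg.arc_ne hap hpb (by linarith))
  have hcont : ContinuousAt (arcIntegral chord 0 1) (g p) :=
    (hasDerivAt_arcIntegral hchd zero_le_one hpch).continuousAt
  have hlim₁ : Tendsto (fun ε : ℝ => g p + ε * (Complex.I * deriv g p)) (𝓝[>] 0) (𝓝 (g p)) := by
    have : Tendsto (fun ε : ℝ => g p + ε * (Complex.I * deriv g p)) (𝓝 0)
      (𝓝 (g p + (0 : ℝ) * (Complex.I * deriv g p))) := Continuous.tendsto (by fun_prop) 0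
    simp only [Complex.ofReal_zero, zero_mul, add_zero] at this
    exact this.mono_left nhdsWithin_le_nhds
  have hlim₂ : Tendsto (fun ε : ℝ => g p - ε * (Complex.I * deriv g p)) (𝓝[>] 0) (𝓝 (g p)) := by
    have : Tendsto (fun ε : ℝ => g p - ε * (Complex.I * deriv g p)) (𝓝 0)
      (𝓝 (g p - (0 : ℝ) * (Complex.I * deriv g p))) := Continuous.tendsto (by fun_prop) 0
    simp only [Complex.ofReal_zero, zero_mul, sub_zero] at this
    exact this.mono_left nhdsWithin_le_nhds
  have hsum := hjump.add ((hcont.tendsto.comp hlim₁).sub (hcont.tendsto.comp hlim₂))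
  have hzero : ∀ᶠ ε : ℝ in 𝓝[>] 0,
      arcIntegral g a b (g p + ε * (Complex.I * deriv g p)) -
      arcIntegral g a b (g p - ε * (Complex.I * deriv g p)) +
      (arcIntegral chord 0 1 (g p + ε * (Complex.I * deriv g p)) -
      arcIntegral chord 0 1 (g p - ε * (Complex.I * deriv g p))) = 0 := by
    -- Both points of the normal at `p` lie in the connected set, so the integral over the loop
    -- agrees at them.
    filter_upwards [eventually_left_mem_disc (hg.regular p) (2 * y)⁻¹,
      eventually_mem_rightSide (hg.regular p) K, hlim₁.eventually (Metric.ball_mem_nhds _ hδ)]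
      with ε e1 e2 e3
    rw [mem_disc_iff_mem_ball hy, ← hc₂, ← hr₂] at e1
    have := eq_of_deriv_eq_zero_of_isPreconnected hC
      (fun z hz => hasDerivAt_arcIntegral_add_chord hg.smooth (by linarith)
        (fun h => hz (Or.inl h)) (fun h => hz (Or.inr h))) hS hdisj
      (Or.inr ⟨e1, e3⟩) (Or.inl (Or.inl (Or.inr e2)))
    linear_combination this
  have := tendsto_nhds_unique (hsum.congr' hzero) tendsto_const_nhds
  simp [Real.pi_ne_zero] at this

end

/-! ### Osculating circles between contact points -/

section

variable {g : ℝ → ℂ} {L K : ℝ}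

/-- Clearing denominators removes the exclusion of `g r = g t`. What remains is a closed condition
in `t` and `c`, and one that is smooth in `r`. -/
theorem supp_iff {t c : ℝ} :
    Supp g t c ↔ ∀ r, -(deriv g t * (starRingEnd ℂ) (g r - g t)).im ≤
      c * Complex.normSq (g r - g t) := by
  refine forall_congr' fun r => ?_
  rcases eq_or_ne (g r) (g t) with h | h
  · simp [h]
  have hpos : 0 < Complex.normSq (g r - g t) := Complex.normSq_pos.2 (sub_ne_zero.2 h)
  simp only [h, ne_eq, not_false_iff, true_imp_iff, lam]
  rw [← div_le_iff₀ hpos]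
  have : (deriv g t / (g r - g t)).im =
      (deriv g t * (starRingEnd ℂ) (g r - g t)).im / Complex.normSq (g r - g t) := by
    rw [Complex.div_im, Complex.mul_im, Complex.conj_re, Complex.conj_im]
    field_simp
    ring
  rw [this, neg_div]

theorem lamc_of_ne {t s : ℝ} (h : g s ≠ g t) : lamc g t s = lam g t s :=
  if_neg (by rintro rfl; exact h rfl)

theorem IsJordan.isCompact_contact (hg : IsJordan g L) {a b : ℝ} (hab : b < a + L) :
    IsCompact {p ∈ Icc a b ×ˢ Icc a b | Supp g p.1 (lamc g p.1 p.2)} := by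
  have hD : IsCompact (Icc a b ×ˢ Icc a b) := isCompact_Icc.prod isCompact_Icc
  have hsub : Icc a b ×ˢ Icc a b ⊆ {p : ℝ × ℝ | |p.2 - p.1| < L} := by
    rintro ⟨t, s⟩ ⟨⟨h1, h2⟩, h3, h4⟩
    simp only [mem_ofPred_eq, abs_lt] at *
    constructor <;> linarith
  have hlam := hg.continuousOn_lamc.mono hsub
  have hc := hg.smooth.continuous
  have hc' := hg.continuous_deriv
  refine hD.of_isClosed_subset ?_ (sep_subset _ _)
  have heq : {p ∈ Icc a b ×ˢ Icc a b | Supp g p.1 (lamc g p.1 p.2)} =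
      ⋂ r : ℝ, {p ∈ Icc a b ×ˢ Icc a b | -(deriv g p.1 * (starRingEnd ℂ) (g r - g p.1)).im ≤
        lamc g p.1 p.2 * Complex.normSq (g r - g p.1)} := by
    ext p
    simp only [supp_iff, mem_iInter, mem_ofPred_eq, forall_and, forall_const]
  rw [heq]
  refine isClosed_iInter fun r => hD.isClosed.isClosed_le ?_ ?_
  · apply Continuous.continuousOn
    exact (Complex.continuous_im.comp ((hc'.comp continuous_fst).mul
      (Complex.continuous_conj.comp (continuous_const.sub (hc.comp continuous_fst))))).neg
  · exact hlam.mul (Complex.continuous_normSq.comp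
      (continuous_const.sub (hc.comp continuous_fst))).continuousOn

/-- All generalized discs tangent to the curve from the left and not meeting it are bounded. -/
def BoundedDiscs (g : ℝ → ℂ) : Prop := ∀ t c, Supp g t c → 0 < c

theorem Supp.exists_isIncircle (hK : IsCurvBound g K) (hg : IsJordan g L) (hb : BoundedDiscs g)
    {t s : ℝ} (hs : g s ≠ g t) (h : Supp g t (lam g t s)) :
    ∃ c r, IsIncircle g K c r ∧ dist (g t) c = r ∧ dist (g s) c = r := by
  have hpos := hb t _ h
  set y := (2 * lam g t s)⁻¹ with hy
  have hy0 : 0 < y := by positivity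
  have hy1 : (2 * y)⁻¹ = lam g t s := by rw [hy]; field_simp
  rw [← hy1] at h
  exact ⟨_, _, h.isIncircle hK hg hy0, dist_self_center hy0, (dist_eq_iff_lam hy0 hs).2 hy1.symm⟩

theorem IsIncircle.supp_lam (hg : IsJordan g L) {c : ℂ} {r : ℝ} (h : IsIncircle g K c r)
    {p q : ℝ} (hp : dist (g p) c = r) (hq : dist (g q) c = r) (hpq : g q ≠ g p) :
    Supp g p (lam g p q) := by
  obtain ⟨y, hy, rfl, rfl, hs⟩ := h.exists_tangent hg hp
  rwa [(dist_eq_iff_lam hy hpq).1 hq]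

/-- Incircles touching the curve at a common point and at two further points coincide. -/
theorem IsIncircle.dist_eq_of_common (hg : IsJordan g L) {c₁ c₂ : ℂ} {r₁ r₂ : ℝ}
    (h₁ : IsIncircle g K c₁ r₁) (h₂ : IsIncircle g K c₂ r₂) {e e' p : ℝ}
    (he₁ : dist (g e) c₁ = r₁) (he' : dist (g e') c₁ = r₁) (he₂ : dist (g e) c₂ = r₂)
    (hp : dist (g p) c₂ = r₂) (hne : g e' ≠ g e) (hne' : g p ≠ g e) : dist (g p) c₁ = r₁ := by
  obtain ⟨y₁, hy₁, rfl, rfl, hs₁⟩ := h₁.exists_tangent hg he₁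
  obtain ⟨y₂, hy₂, rfl, rfl, hs₂⟩ := h₂.exists_tangent hg he₂
  rw [dist_eq_iff_lam hy₁ hne] at he'
  rw [dist_eq_iff_lam hy₂ hne'] at hp
  rw [dist_eq_iff_lam hy₁ hne']
  refine le_antisymm (hs₁ p hne') ?_
  rw [← he', hp]
  exact hs₂ e' hne

/-- The maximum of `lamc` is attained either on the diagonal or at a genuine second contact, which
may be moved into any prescribed period. -/
theorem IsJordan.osc_or_contact (hg : IsJordan g L) (a p : ℝ) :
    Osc g p ∨ ∃ s ∈ Ico a (a + L), g s ≠ g p ∧ Supp g p (lam g p s) := by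
  have hL := hg.pos
  obtain ⟨s, h1, h2, h3⟩ := hg.exists_contact p
  rcases eq_or_ne s p with rfl | hsp
  · left
    rwa [lamc, if_pos rfl] at h3
  · right
    have hne : g s ≠ g p := hg.ne_of_abs_lt hsp (by rw [abs_lt]; constructor <;> linarith)
    obtain ⟨s', hs', h4, -⟩ := hg.exists_window a s
    refine ⟨s', hs', h4 ▸ hne, ?_⟩
    have : lam g p s' = lam g p s := by simp only [lam, h4]
    rwa [this, ← lamc_of_ne hne]

/-- A contact pair at minimal parameter distance in `[a, b]` must be degenerate. The contact set
includes the diagonal, where contact means osculation, and is therefore compact. -/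
theorem IsIncircle.exists_osc_Icc (hK : IsCurvBound g K) (hg : IsJordan g L) (hb : BoundedDiscs g)
    {c : ℂ} {r : ℝ} (h : IsIncircle g K c r) {a b : ℝ} (hab : a < b) (hba : b < a + L)
    (ha : dist (g a) c = r) (hb' : dist (g b) c = r) : ∃ x ∈ Icc a b, Osc g x := by
  have hne : g b ≠ g a := (hg.inj a b hab hba).symm
  obtain ⟨⟨t, s⟩, ⟨⟨ht, hs⟩, hts⟩, hmin⟩ := (hg.isCompact_contact hba).exists_isMinOn
    (f := fun p : ℝ × ℝ => |p.2 - p.1|)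
    ⟨(a, b), ⟨left_mem_Icc.2 hab.le, right_mem_Icc.2 hab.le⟩, by
      simp only
      rw [lamc_of_ne hne]
      exact h.supp_lam hg ha hb' hne⟩ (by fun_prop)
  simp only at ht hs hts
  rcases eq_or_ne s t with rfl | hst
  · rw [lamc, if_pos rfl] at hts
    exact ⟨s, hs, hts⟩
  have hmin' : ∀ t' ∈ Icc a b, ∀ s' ∈ Icc a b, g s' ≠ g t' → Supp g t' (lam g t' s') →
      |s - t| ≤ |s' - t'| := fun t' ht' s' hs' hne' hsup =>
    hmin (a := (t', s')) ⟨⟨ht', hs'⟩, by simpa only [lamc_of_ne hne'] using hsup⟩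
  have hne₁ : g s ≠ g t := hg.ne_of_abs_lt hst (by
    rw [abs_lt]; constructor <;> linarith [ht.1, ht.2, hs.1, hs.2])
  rw [lamc_of_ne hne₁] at hts
  obtain ⟨c₁, r₁, h₁, ht₁, hs₁⟩ := hts.exists_isIncircle hK hg hb hne₁
  obtain ⟨a', b', hab', hset⟩ : ∃ a' b', a' < b' ∧ ((a' = t ∧ b' = s) ∨ (a' = s ∧ b' = t)) := by
    rcases lt_or_gt_of_ne hst with h | h
    · exact ⟨s, t, h, Or.inr ⟨rfl, rfl⟩⟩
    · exact ⟨t, s, h, Or.inl ⟨rfl, rfl⟩⟩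
  have hta : |s - t| = b' - a' := by
    rcases hset with ⟨rfl, rfl⟩ | ⟨rfl, rfl⟩
    · rw [abs_of_pos (by linarith)]
    · rw [abs_of_neg (by linarith)]; ring
  have ha₁ : dist (g a') c₁ = r₁ := by rcases hset with ⟨rfl, rfl⟩ | ⟨rfl, rfl⟩ <;> assumption
  have hb₁ : dist (g b') c₁ = r₁ := by rcases hset with ⟨rfl, rfl⟩ | ⟨rfl, rfl⟩ <;> assumption
  have ha'I : a' ∈ Icc a b := by rcases hset with ⟨rfl, rfl⟩ | ⟨rfl, rfl⟩ <;> assumption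
  have hb'I : b' ∈ Icc a b := by rcases hset with ⟨rfl, rfl⟩ | ⟨rfl, rfl⟩ <;> assumption
  -- Every point of `[a', b']` is within half the minimal distance of `p`, so `p` has no second
  -- contact there.
  set p := (a' + b') / 2 with hp
  have hpI : p ∈ Icc a b := ⟨by linarith [ha'I.1], by linarith [hb'I.2]⟩
  rcases hg.osc_or_contact a' p with hosc | ⟨q, hq, hqp, hsup⟩
  · exact ⟨p, hpI, hosc⟩
  exfalso
  rcases le_or_gt q b' with hqb | hqb
  · have h2 := hmin' p hpI q ⟨ha'I.1.trans hq.1, hqb.trans hb'I.2⟩ hqp hsup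
    have h3 : |q - p| ≤ (b' - a') / 2 := by
      rw [abs_le]; constructor <;> linarith [hq.1]
    linarith
  -- A contact beyond `b'` interlaces with the minimal pair, so `g p` lies on the first circle and
  -- `(a', p)` is a closer pair.
  · obtain ⟨c₂, r₂, h₂, hp₂, hq₂⟩ := hsup.exists_isIncircle hK hg hb hqp
    have h3 := h₁.dist_eq_of_interlaced hK hg h₂ (a := a') (p := p) (b := b') (q := q)
      (by linarith) (by linarith) hqb hq.2 ha₁ hb₁ hp₂ hq₂
    have hpa : g p ≠ g a' := (hg.inj a' p (by linarith) (by linarith [hb'I.2, ha'I.1])).symm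
    have h4 := hmin' a' ha'I p hpI hpa (h₁.supp_lam hg ha₁ h3 hpa)
    rw [abs_of_pos (by linarith : 0 < p - a')] at h4
    linarith

/-- If no interior point osculates, each has a second contact. By the closed version that contact is
not interior, and in every remaining position of it the point is forced onto the given circle. The
whole arc then lies on the circle, and the closed version applies to a smaller arc. -/
theorem IsIncircle.exists_osc_Ioo (hK : IsCurvBound g K) (hg : IsJordan g L) (hb : BoundedDiscs g)
    {c : ℂ} {r : ℝ} (h : IsIncircle g K c r) {a b : ℝ} (hab : a < b) (hba : b < a + L)
    (ha : dist (g a) c = r) (hb' : dist (g b) c = r) : ∃ x ∈ Ioo a b, Osc g x := by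
  by_contra! hno
  have key : ∀ p ∈ Ioo a b, dist (g p) c = r := by
    rintro p ⟨hap, hpb⟩
    rcases hg.osc_or_contact a p with hosc | ⟨q, hq, hqp, hsup⟩
    · exact absurd hosc (hno p ⟨hap, hpb⟩)
    obtain ⟨c₂, r₂, h₂, hp₂, hq₂⟩ := hsup.exists_isIncircle hK hg hb hqp
    have hab' : g a ≠ g b := hg.inj a b hab hba
    rcases hq.1.eq_or_lt with rfl | haq
    · exact h.dist_eq_of_common hg h₂ ha hb' hq₂ hp₂ hab'.symm hqp.symm
    rcases lt_trichotomy q b with hqb | rfl | hqb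
    · exfalso
      rcases lt_trichotomy q p with hlt | rfl | hlt
      · obtain ⟨x, hx, hx'⟩ := h₂.exists_osc_Icc hK hg hb hlt (by linarith) hq₂ hp₂
        exact hno x ⟨by linarith [hx.1], by linarith [hx.2]⟩ hx'
      · exact hqp rfl
      · obtain ⟨x, hx, hx'⟩ := h₂.exists_osc_Icc hK hg hb hlt (by linarith) hp₂ hq₂
        exact hno x ⟨by linarith [hx.1], by linarith [hx.2]⟩ hx'
    · exact h.dist_eq_of_common hg h₂ hb' ha hq₂ hp₂ hab' hqp.symm
    · exact h.dist_eq_of_interlaced hK hg h₂ hap hpb hqb hq.2 ha hb' hp₂ hq₂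
  obtain ⟨x, hx, hx'⟩ := h.exists_osc_Icc hK hg hb
    (show a + (b - a) / 3 < a + 2 * (b - a) / 3 by linarith) (by linarith)
    (key _ ⟨by linarith, by linarith⟩) (key _ ⟨by linarith, by linarith⟩)
  exact hno x ⟨by linarith [hx.1], by linarith [hx.2]⟩ hx'

theorem BoundedDiscs.exists_osc_of_contact (hb : BoundedDiscs g) (hg : IsJordan g L)
    {t s : ℝ} (hts : t < s) (hst : s < t + L)
    (h : Supp g t (lam g t s)) :
    (∃ x ∈ Ioo t s, Osc g x) ∧ ∃ x ∈ Ioo s (t + L), Osc g x := by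
  obtain ⟨K, hK0, hK'⟩ := hg.exists_bound
  have hK : IsCurvBound g K := ⟨hK0, hK'⟩
  obtain ⟨c, r, hc, h1, h2⟩ := h.exists_isIncircle hK hg hb (hg.inj t s hts hst).symm
  exact ⟨hc.exists_osc_Ioo hK hg hb hts hst h1 h2,
    hc.exists_osc_Ioo hK hg hb hst (by linarith) h2 (by rwa [hg.periodic])⟩

end

/-! ### Inversion -/

/-- The image of a curve under the Möbius transformation `z ↦ (z - z₀)⁻¹`. -/
noncomputable def mobius (g : ℝ → ℂ) (z₀ : ℂ) (t : ℝ) : ℂ := (g t - z₀)⁻¹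

section mobius

variable {g : ℝ → ℂ} {L : ℝ} {z₀ : ℂ}

theorem deriv_mobius (hg : IsJordan g L) (hz : z₀ ∉ range g) (t : ℝ) :
    deriv (mobius g z₀) t = -deriv g t / (g t - z₀) ^ 2 := by
  have h0 : g t - z₀ ≠ 0 := sub_ne_zero.2 fun h => hz ⟨t, h⟩
  exact (((hg.differentiable t).hasDerivAt.sub_const z₀).fun_inv h0).deriv

theorem IsJordan.mobius (hg : IsJordan g L) (hz : z₀ ∉ range g) : IsJordan (mobius g z₀) L where
  pos := hg.pos
  smooth := (hg.smooth.sub contDiff_const).inv fun t => sub_ne_zero.2 fun h => hz ⟨t, h⟩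
  regular t := by
    have h0 : g t - z₀ ≠ 0 := sub_ne_zero.2 fun h => hz ⟨t, h⟩
    rw [deriv_mobius hg hz]
    exact div_ne_zero (neg_ne_zero.2 (hg.regular t)) (pow_ne_zero _ h0)
  periodic t := by simp only [PlaneCurve.mobius, hg.periodic t]
  inj s t h1 h2 h := by
    simp only [PlaneCurve.mobius, inv_inj, sub_left_inj] at h
    exact hg.inj s t h1 h2 h

theorem mobius_eq_iff {s t : ℝ} : mobius g z₀ s = mobius g z₀ t ↔ g s = g t := by
  simp [mobius]

/-- At each `t` the map changes the parameters of all tangent circles by the same constant. By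
`osc_mobius` the osculating parameter changes by that constant too, so supporting and osculating
circles are preserved. -/
theorem lam_mobius (hg : IsJordan g L) (hz : z₀ ∉ range g) {s t : ℝ} (h : g s ≠ g t) :
    lam (mobius g z₀) t s = lam g t s - (deriv g t / (g t - z₀)).im := by
  have h0 : g t - z₀ ≠ 0 := sub_ne_zero.2 fun h => hz ⟨t, h⟩
  have h1 : g s - z₀ ≠ 0 := sub_ne_zero.2 fun h => hz ⟨s, h⟩
  have h2 : g s - g t ≠ 0 := sub_ne_zero.2 h
  have h3 : (g s - z₀)⁻¹ - (g t - z₀)⁻¹ = -(g s - g t) / ((g s - z₀) * (g t - z₀)) := by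
    rw [inv_sub_inv h1 h0]
    congr 1
    ring
  have : deriv (mobius g z₀) t / (mobius g z₀ s - mobius g z₀ t) =
      deriv g t / (g s - g t) + deriv g t / (g t - z₀) := by
    rw [deriv_mobius hg hz, mobius, mobius, h3]
    field_simp
    ring
  rw [lam, lam, this, Complex.add_im]
  ring

theorem osc_mobius (hg : IsJordan g L) (hz : z₀ ∉ range g) (t : ℝ) :
    osc (mobius g z₀) t = osc g t - (deriv g t / (g t - z₀)).im := by
  have h0 : g t - z₀ ≠ 0 := sub_ne_zero.2 fun h => hz ⟨t, h⟩
  have hT := hg.regular t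
  have h1 : deriv (mobius g z₀) = fun t => -deriv g t / (g t - z₀) ^ 2 :=
    funext (deriv_mobius hg hz)
  have h2 : HasDerivAt (deriv g) (deriv (deriv g) t) t :=
    (((contDiff_deriv hg.smooth).differentiable (by simp)) t).hasDerivAt
  have h3 := h2.fun_neg.fun_div (((hg.differentiable t).hasDerivAt.sub_const z₀).fun_pow 2)
    (pow_ne_zero 2 h0)
  have h4 : deriv (deriv (mobius g z₀)) t / deriv (mobius g z₀) t =
      deriv (deriv g) t / deriv g t - ((2 : ℝ) : ℂ) * (deriv g t / (g t - z₀)) := by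
    rw [h1, h3.deriv]
    push_cast
    field_simp
    ring
  rw [osc, osc, h4, Complex.sub_im, Complex.im_ofReal_mul]
  ring

theorem supp_mobius (hg : IsJordan g L) (hz : z₀ ∉ range g) {t c : ℝ} :
    Supp (mobius g z₀) t (c - (deriv g t / (g t - z₀)).im) ↔ Supp g t c := by
  refine forall_congr' fun r => ?_
  rw [Ne, mobius_eq_iff]
  refine imp_congr_right fun h => ?_
  rw [lam_mobius hg hz h]
  constructor <;> intro h' <;> linarith

theorem osc_mobius_iff (hg : IsJordan g L) (hz : z₀ ∉ range g) {t : ℝ} :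
    Osc (mobius g z₀) t ↔ Osc g t := by
  rw [Osc, osc_mobius hg hz, supp_mobius hg hz, Osc]

/-- If `c ≤ 0`, the corresponding empty disc of `g` has `z₀` in its closure. The right side is an
open set around `z₀`, so the disc would meet it. -/
theorem boundedDiscs_mobius {K : ℝ} (hK : IsCurvBound g K) (hg : IsJordan g L)
    (hz : z₀ ∈ rightSide g K) : BoundedDiscs (mobius g z₀) := by
  have hz' : z₀ ∉ range g := disjoint_left.1 hK.disjoint_rightSide hz
  intro t c hc
  have hT := hg.regular t
  set m := (deriv g t / (g t - z₀)).im with hm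
  have hs : Supp g t (c + m) := by
    rw [← supp_mobius hg hz', ← hm, add_sub_cancel_right]
    exact hc
  by_contra! hneg
  have h0 : z₀ - g t ≠ 0 := sub_ne_zero.2 fun h => hz' ⟨t, h.symm⟩
  set w := deriv g t / (z₀ - g t) with hw
  have hwm : w.im = -m := by
    rw [hw, hm, ← neg_sub z₀ (g t), div_neg, Complex.neg_im, neg_neg]
  have hw0 : w ≠ 0 := div_ne_zero hT h0
  have hlim : Tendsto (fun η : ℝ => g t + deriv g t / (w - η * Complex.I)) (𝓝[>] 0) (𝓝 z₀) := by
    have hc : ContinuousAt (fun η : ℝ => g t + deriv g t / (w - η * Complex.I)) 0 := by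
      refine continuousAt_const.add (continuousAt_const.div (by fun_prop) (by simpa))
    have := hc.tendsto
    simp only [Complex.ofReal_zero, zero_mul, sub_zero, hw, div_div_cancel₀ hT] at this
    rw [add_sub_cancel] at this
    exact this.mono_left nhdsWithin_le_nhds
  have hne : ∀ᶠ η : ℝ in 𝓝[>] 0, w - η * Complex.I ≠ 0 := by
    have hc : ContinuousAt (fun η : ℝ => w - η * Complex.I) 0 := by fun_prop
    exact (hc.eventually_ne (by simpa)).filter_mono nhdsWithin_le_nhds
  obtain ⟨η, h1, h2, h3⟩ := ((hlim.eventually ((isOpen_rightSide hK.pos).mem_nhds hz)).and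
    (hne.and self_mem_nhdsWithin)).exists
  refine disjoint_left.1 (hK.disjoint_disc_rightSide hg hs) ?_ h1
  rw [disc_eq_image hT]
  refine ⟨_, ⟨?_, h2⟩, rfl⟩
  have h3 : 0 < η := h3
  have h4 : (w - η * Complex.I).im = -m - η := by
    rw [Complex.sub_im, hwm, Complex.im_ofReal_mul, Complex.I_im, mul_one]
  rw [h4]
  linarith

end mobius

theorem IsJordan.exists_osc_of_contact {g : ℝ → ℂ} {L : ℝ} (hg : IsJordan g L) {t s : ℝ}
    (hts : t < s) (hst : s < t + L) (h : Supp g t (lam g t s)) :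
    (∃ x ∈ Ioo t s, Osc g x) ∧ ∃ x ∈ Ioo s (t + L), Osc g x := by
  obtain ⟨K, hK0, hK'⟩ := hg.exists_bound
  have hK : IsCurvBound g K := ⟨hK0, hK'⟩
  obtain ⟨ε, hε⟩ := (eventually_mem_rightSide (hg.regular 0) K).exists
  have hz := disjoint_left.1 hK.disjoint_rightSide hε
  have hne : g s ≠ g t := (hg.inj t s hts hst).symm
  have := (boundedDiscs_mobius hK hg hε).exists_osc_of_contact (hg.mobius hz) hts hst
    (by rwa [lam_mobius hg hz hne, supp_mobius hg hz])
  simpa only [osc_mobius_iff hg hz] using this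

/-- The curve has two osculating circles supporting it from the left. -/
theorem IsJordan.exists_two_osc {g : ℝ → ℂ} {L : ℝ} (hg : IsJordan g L) :
    ∃ x y, x < y ∧ y < x + L ∧ Osc g x ∧ Osc g y := by
  have hL := hg.pos
  by_cases hall : ∀ t, Osc g t
  · exact ⟨0, L / 2, by linarith, by linarith, hall _, hall _⟩
  push Not at hall
  obtain ⟨t, ht⟩ := hall
  rcases hg.osc_or_contact t t with h | ⟨s, hs, hne, hsup⟩
  · exact absurd h ht
  have hts : t < s := lt_of_le_of_ne hs.1 (by rintro rfl; exact hne rfl)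
  obtain ⟨⟨x, hx, hx'⟩, y, hy, hy'⟩ := hg.exists_osc_of_contact hts hs.2 hsup
  exact ⟨x, y, hx.2.trans hy.1, by linarith [hx.1, hy.2], hx', hy'⟩

/-! ### Reversal of orientation and the four osculating circles -/

/-- The curve with the opposite orientation. -/
def rev (g : ℝ → ℂ) (t : ℝ) : ℂ := g (-t)

/-- The osculating circle supports the curve from the right. -/
def OscRight (g : ℝ → ℂ) (t : ℝ) : Prop := Osc (rev g) (-t)

/-- The osculating circle, as a subset of the complex plane. -/
def circ (g : ℝ → ℂ) (t : ℝ) : Set ℂ := {z | z = g t ∨ -(deriv g t / (z - g t)).im = osc g t}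

section rev

variable {g : ℝ → ℂ} {L K : ℝ}

theorem deriv_rev (g : ℝ → ℂ) (t : ℝ) : deriv (rev g) t = -deriv g (-t) :=
  deriv_comp_neg g t

theorem range_rev (g : ℝ → ℂ) : range (rev g) = range g :=
  (Equiv.neg ℝ).surjective.range_comp g

theorem IsJordan.rev (hg : IsJordan g L) : IsJordan (rev g) L where
  pos := hg.pos
  smooth := hg.smooth.comp contDiff_neg
  regular t := by rw [deriv_rev]; exact neg_ne_zero.2 (hg.regular _)
  periodic t := by
    have := hg.periodic.sub_eq (-t)
    simp only [PlaneCurve.rev, neg_add']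
    exact this
  inj s t h1 h2 := (hg.inj (-t) (-s) (by linarith) (by linarith)).symm

theorem lam_rev (g : ℝ → ℂ) (t s : ℝ) : lam (rev g) t s = -lam g (-t) (-s) := by
  simp [lam, deriv_rev, rev, neg_div]

theorem osc_rev (g : ℝ → ℂ) (t : ℝ) : osc (rev g) t = -osc g (-t) := by
  have h : deriv (rev g) = fun t => -deriv g (-t) := funext (deriv_rev g)
  have h2 : deriv (deriv (rev g)) t = deriv (deriv g) (-t) := by
    rw [h, deriv.fun_neg, deriv_comp_neg, neg_neg]
  rw [osc, osc, h2, deriv_rev, div_neg, Complex.neg_im, neg_div]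

theorem circ_rev (g : ℝ → ℂ) (t : ℝ) : circ (rev g) t = circ g (-t) := by
  ext z
  simp only [circ, osc_rev, deriv_rev, rev, neg_div, Complex.neg_im, neg_inj, mem_ofPred_eq]

theorem leftSide_rev (g : ℝ → ℂ) (K : ℝ) : leftSide (rev g) K = rightSide g K := by
  ext z
  simp only [leftSide, rightSide, deriv_rev, rev, neg_div, Complex.neg_im, neg_neg, mem_ofPred_eq]
  exact ⟨fun ⟨t, h⟩ => ⟨-t, h⟩, fun ⟨t, h⟩ => ⟨-t, by rwa [neg_neg]⟩⟩

theorem IsCurvBound.rev (hK : IsCurvBound g K) : IsCurvBound (rev g) K where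
  pos := hK.pos
  abs_lam_lt t s := by rw [lam_rev, abs_neg]; exact hK.abs_lam_lt _ _

theorem supp_rev_iff {t c : ℝ} : Supp (rev g) t c ↔ ∀ r, g r ≠ g (-t) → -c ≤ lam g (-t) r := by
  constructor
  · intro h r hr
    have := h (-r) (by simpa [PlaneCurve.rev] using hr)
    rw [lam_rev, neg_neg] at this
    linarith
  · intro h r hr
    have := h (-r) hr
    rw [lam_rev]
    linarith

/-- For the reversed curve, left discs are the complementary discs on the other side of the same
tangent circles. -/
theorem mem_disc_rev {t c : ℝ} {z : ℂ} :
    z ∈ disc (rev g) (-t) (-c) ↔ z ≠ g t ∧ -(deriv g t / (z - g t)).im < c := by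
  simp only [disc, deriv_rev, rev, neg_div, Complex.neg_im, neg_neg, mem_ofPred_eq]
  refine and_congr_right fun _ => ?_
  constructor <;> intro h <;> linarith

end rev

section four

variable {g : ℝ → ℂ} {L : ℝ}

theorem IsJordan.periodic_osc (hg : IsJordan g L) : Function.Periodic (osc g) L := by
  intro t
  have h : deriv (deriv g) (t + L) = deriv (deriv g) t := by
    have : (fun x => deriv g (x + L)) = deriv g := funext hg.periodic_deriv
    rw [← deriv_comp_add_const, this]
  rw [osc, osc, h, hg.periodic_deriv]

theorem IsJordan.periodic_isOsc (hg : IsJordan g L) : Function.Periodic (Osc g) L := by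
  intro t
  simp only [Osc, Supp, lam, hg.periodic_osc t, hg.periodic t, hg.periodic_deriv t]

theorem IsJordan.periodic_oscRight (hg : IsJordan g L) : Function.Periodic (OscRight g) L := by
  intro t
  have := hg.rev.periodic_isOsc (-t - L)
  rw [sub_add_cancel] at this
  rw [OscRight, OscRight, this]
  congr 1
  ring

theorem IsJordan.sub_eq_zsmul (hg : IsJordan g L) {s t : ℝ} (h : g s = g t) :
    ∃ n : ℤ, s = t + n • L := by
  obtain ⟨n, hn, -⟩ := existsUnique_add_zsmul_mem_Ico hg.pos s t
  refine ⟨-n, ?_⟩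
  have h1 : g (s + n • L) = g t := by rw [← h]; exact hg.periodic.zsmul n s
  rcases hn.1.eq_or_lt with h2 | h2
  · rw [neg_smul]; linarith
  · exact absurd h1.symm (hg.inj t _ h2 hn.2)

theorem IsJordan.exists_two_osc_two_oscRight (hg : IsJordan g L) :
    ∃ x₁ x₂ y₁ y₂, Osc g x₁ ∧ Osc g x₂ ∧ OscRight g y₁ ∧ OscRight g y₂ ∧
      g x₁ ≠ g x₂ ∧ g x₁ ≠ g y₁ ∧ g x₁ ≠ g y₂ ∧ g x₂ ≠ g y₁ ∧ g x₂ ≠ g y₂ ∧ g y₁ ≠ g y₂ := by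
  have hL := hg.pos
  by_cases hcase : ∃ t, Osc g t ∧ OscRight g t
  · obtain ⟨t, h1, h2⟩ := hcase
    -- Support from both sides forces the curve onto its osculating generalized circle at `t`. Every
    -- pair containing `t` is then a contact pair, and the arcs they cut off provide distinct
    -- points.
    have hconst : ∀ r, g r ≠ g t → lam g t r = osc g t := by
      intro r hr
      refine le_antisymm (h1 r hr) ?_
      rw [OscRight, Osc, supp_rev_iff, osc_rev, neg_neg, neg_neg] at h2
      exact h2 r hr
    have hne : ∀ s, t < s → s < t + L → g s ≠ g t := fun s h h' => (hg.inj t s h h').symm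
    have hs : Supp g t (lam g t (t + L / 2)) := by
      rw [hconst _ (hne _ (by linarith) (by linarith))]
      exact h1
    obtain ⟨⟨x, hx, hx'⟩, -⟩ := hg.exists_osc_of_contact (by linarith) (by linarith) hs
    -- Under reversal `-x` precedes `-t`, so a period is added to place it after.
    have hs' : Supp (PlaneCurve.rev g) (-t) (lam (PlaneCurve.rev g) (-t) (-x + L)) := by
      have e : PlaneCurve.rev g (-x + L) = PlaneCurve.rev g (-x) := hg.rev.periodic _
      have e2 : lam (PlaneCurve.rev g) (-t) (-x + L) = lam (PlaneCurve.rev g) (-t) (-x) := by simp only [lam, e]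
      rw [e2, lam_rev, neg_neg, neg_neg, hconst x (hne x hx.1 (by linarith [hx.2]))]
      rw [OscRight, Osc, osc_rev, neg_neg] at h2
      exact h2
    obtain ⟨⟨y₁, hy₁, hy₁'⟩, y₂, hy₂, hy₂'⟩ :=
      hg.rev.exists_osc_of_contact (by linarith [hx.2]) (by linarith [hx.1]) hs'
    have e1 := hx.1
    have e2 := hx.2
    have e3 := hy₁.1
    have e4 := hy₁.2
    have e5 := hy₂.1
    have e6 := hy₂.2
    have hxL : g (x - L) = g x := hg.periodic.sub_eq x
    refine ⟨t, x, -y₁, -y₂, h1, hx', by rwa [OscRight, neg_neg], by rwa [OscRight, neg_neg],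
      ?_, ?_, ?_, ?_, ?_, ?_⟩
    · exact hg.inj t x e1 (by linarith)
    · exact (hg.inj (-y₁) t (by linarith) (by linarith)).symm
    · exact (hg.inj (-y₂) t (by linarith) (by linarith)).symm
    · rw [← hxL]; exact hg.inj (x - L) (-y₁) (by linarith) (by linarith)
    · rw [← hxL]; exact (hg.inj (-y₂) (x - L) (by linarith) (by linarith)).symm
    · exact (hg.inj (-y₂) (-y₁) (by linarith) (by linarith)).symm
  · have hdisj : ∀ x y, Osc g x → OscRight g y → g x ≠ g y := by
      intro x y hx hy hxy
      obtain ⟨n, rfl⟩ := hg.sub_eq_zsmul hxy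
      refine hcase ⟨y, ?_, hy⟩
      rwa [hg.periodic_isOsc.zsmul n y] at hx
    obtain ⟨x₁, x₂, hx, hx', hx₁, hx₂⟩ := hg.exists_two_osc
    obtain ⟨y₁, y₂, hy, hy', hy₁, hy₂⟩ := hg.rev.exists_two_osc
    have hy₁' : OscRight g (-y₁) := by rwa [OscRight, neg_neg]
    have hy₂' : OscRight g (-y₂) := by rwa [OscRight, neg_neg]
    exact ⟨x₁, x₂, -y₁, -y₂, hx₁, hx₂, hy₁', hy₂', hg.inj _ _ hx hx', hdisj _ _ hx₁ hy₁',
      hdisj _ _ hx₁ hy₂', hdisj _ _ hx₂ hy₁', hdisj _ _ hx₂ hy₂', hg.rev.inj _ _ hy hy'⟩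

end four

/-! ### Components of the complement -/

section support

variable {g : ℝ → ℂ} {L K : ℝ}

/-- In the coordinate `w` a boundary point is approached by moving down by `η`. The point of
tangency, where `w` is infinite, is approached along the normal. -/
theorem subset_closure_disc {t : ℝ} (hT : deriv g t ≠ 0) (c : ℝ) :
    {z | z = g t ∨ c ≤ -(deriv g t / (z - g t)).im} ⊆ closure (disc g t c) := by
  intro z hz
  by_cases hzt : z = g t
  · subst hzt
    refine mem_closure_of_tendsto (f := fun ε : ℝ => g t + ε * (Complex.I * deriv g t))
      (b := 𝓝[>] (0 : ℝ)) ?_ (eventually_left_mem_disc hT c)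
    have : Tendsto (fun ε : ℝ => g t + ε * (Complex.I * deriv g t)) (𝓝 0)
        (𝓝 (g t + (0 : ℝ) * (Complex.I * deriv g t))) := Continuous.tendsto (by fun_prop) 0
    simp only [Complex.ofReal_zero, zero_mul, add_zero] at this
    exact this.mono_left nhdsWithin_le_nhds
  have hz' : c ≤ -(deriv g t / (z - g t)).im := hz.resolve_left hzt
  set w := deriv g t / (z - g t) with hw
  have h0 : z - g t ≠ 0 := sub_ne_zero.2 hzt
  have hw0 : w ≠ 0 := div_ne_zero hT h0
  have hlim : Tendsto (fun η : ℝ => g t + deriv g t / (w - η * Complex.I)) (𝓝[>] 0) (𝓝 z) := by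
    have hc : ContinuousAt (fun η : ℝ => g t + deriv g t / (w - η * Complex.I)) 0 := by
      refine continuousAt_const.add (continuousAt_const.div (by fun_prop) (by simpa))
    have := hc.tendsto
    simp only [Complex.ofReal_zero, zero_mul, sub_zero, hw, div_div_cancel₀ hT] at this
    rw [add_sub_cancel] at this
    exact this.mono_left nhdsWithin_le_nhds
  have hne : ∀ᶠ η : ℝ in 𝓝[>] 0, w - η * Complex.I ≠ 0 := by
    have hc : ContinuousAt (fun η : ℝ => w - η * Complex.I) 0 := by fun_prop
    exact (hc.eventually_ne (by simpa)).filter_mono nhdsWithin_le_nhds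
  refine mem_closure_of_tendsto hlim ?_
  filter_upwards [hne, self_mem_nhdsWithin] with η h1 h2
  rw [disc_eq_image hT]
  refine ⟨_, ⟨?_, h1⟩, rfl⟩
  have h3 : 0 < η := h2
  have h4 : (w - η * Complex.I).im = w.im - η := by
    rw [Complex.sub_im, Complex.im_ofReal_mul, Complex.I_im, mul_one]
  rw [h4]
  linarith

theorem circ_subset_closure_disc {t : ℝ} (hT : deriv g t ≠ 0) :
    circ g t ⊆ closure (disc g t (osc g t)) :=
  Subset.trans (fun _ hz => hz.imp_right fun h => h.ge) (subset_closure_disc hT _)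

/-- An osculating circle that supports the curve from the left has the curve in one of the closed
regions into which it divides the plane. -/
theorem Osc.exists_component (hg : IsJordan g L) {t : ℝ} (h : Osc g t) :
    ∃ z ∈ (circ g t)ᶜ, range g ⊆ closure (connectedComponentIn (circ g t)ᶜ z) := by
  have hT : deriv (rev g) (-t) ≠ 0 := hg.rev.regular _
  have hsub : disc (rev g) (-t) (-osc g t) ⊆ (circ g t)ᶜ := by
    rintro z hz (h1 | h1)
    · exact (mem_disc_rev.1 hz).1 h1
    · exact (mem_disc_rev.1 hz).2.ne h1
  obtain ⟨ε, hε⟩ := (eventually_left_mem_disc hT (-osc g t)).exists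
  refine ⟨_, hsub hε, ?_⟩
  refine Subset.trans ?_ (closure_mono ((isPreconnected_disc hT _).subset_connectedComponentIn
    hε hsub))
  rintro _ ⟨r, rfl⟩
  refine subset_closure_disc hT _ ?_
  by_cases hr : g r = g t
  · left; simpa [rev] using hr
  · right
    have := h r hr
    rw [lam] at this
    simp only [deriv_rev, rev, neg_neg, neg_div, Complex.neg_im]
    linarith

theorem connectedComponentIn_eq_of_mem {F S : Set ℂ} (hS : IsPreconnected S) (hF : S ⊆ F)
    {x y : ℂ} (hx : x ∈ S) (hy : y ∈ S) : connectedComponentIn F x = connectedComponentIn F y :=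
  connectedComponentIn_eq (hS.subset_connectedComponentIn hx hF hy)

/-- The disc bounded by a supporting circle lies in the component of the left side. -/
theorem Supp.connectedComponentIn_eq (hK : IsCurvBound g K) (hg : IsJordan g L) {t c : ℝ}
    (h : Supp g t c) {x z : ℂ} (hx : x ∈ disc g t c) (hz : z ∈ leftSide g K) :
    connectedComponentIn (range g)ᶜ x = connectedComponentIn (range g)ᶜ z := by
  have hconn : IsPreconnected (disc g t c ∪ leftSide g K) := by
    refine (isPreconnected_disc (hg.regular t) c).union' ?_ (hg.isPreconnected_leftSide hK.pos)
    obtain ⟨ε, h1, h2⟩ := ((eventually_left_mem_disc (hg.regular t) c).and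
      (eventually_mem_leftSide (hg.regular t) K)).exists
    exact ⟨_, h1, h2⟩
  refine connectedComponentIn_eq_of_mem hconn ?_ (Or.inl hx) (Or.inr hz)
  rw [subset_compl_iff_disjoint_right, disjoint_union_left]
  exact ⟨h.disjoint_disc, hK.disjoint_leftSide⟩

theorem Osc.circ_subset_closure (hK : IsCurvBound g K) (hg : IsJordan g L) {t : ℝ}
    (h : Osc g t) {z : ℂ} (hz : z ∈ leftSide g K) {P : Set ℂ → Prop}
    (hP : P (connectedComponentIn (range g)ᶜ z)) :
    circ g t ⊆ closure {x | x ∈ (range g)ᶜ ∧ P (connectedComponentIn (range g)ᶜ x)} := by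
  refine (circ_subset_closure_disc (hg.regular t)).trans (closure_mono fun x hx => ⟨?_, ?_⟩)
  · exact disjoint_left.1 (Supp.disjoint_disc h) hx
  · rwa [Supp.connectedComponentIn_eq hK hg h hx hz]

theorem isPreconnected_exterior {R : ℝ} (hR : 0 ≤ R) : IsPreconnected {z : ℂ | R < ‖z‖} := by
  have : {z : ℂ | R < ‖z‖} =
      (fun p : ℝ × ℝ => (p.1 : ℂ) * Complex.exp (p.2 * Complex.I)) '' (Ioi R ×ˢ univ) := by
    ext z
    constructor
    · intro hz
      exact ⟨(‖z‖, z.arg), ⟨hz, mem_univ _⟩, Complex.norm_mul_exp_arg_mul_I z⟩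
    · rintro ⟨⟨r, θ⟩, ⟨hr, -⟩, rfl⟩
      have hr' : R < r := hr
      simp only [mem_ofPred_eq, norm_mul, Complex.norm_exp_ofReal_mul_I, Complex.norm_real,
        mul_one, Real.norm_eq_abs]
      rwa [abs_of_pos (by linarith)]
  rw [this]
  exact (isPreconnected_Ioi.prod isPreconnected_univ).image _ (by fun_prop)

theorem not_isBounded_exterior (R : ℝ) : ¬ Bornology.IsBounded {z : ℂ | R < ‖z‖} := by
  intro h
  obtain ⟨M, hM⟩ := h.exists_norm_le
  have h1 : ‖((max (max R M) 0 + 1 : ℝ) : ℂ)‖ = max (max R M) 0 + 1 := by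
    rw [Complex.norm_real, Real.norm_eq_abs, abs_of_pos (by positivity)]
  have h2 := hM ((max (max R M) 0 + 1 : ℝ) : ℂ) (by
    rw [mem_ofPred_eq, h1]
    linarith [le_max_left R M, le_max_left (max R M) 0])
  rw [h1] at h2
  linarith [le_max_right R M, le_max_left (max R M) 0]

/-- Some exterior of a disc does not meet the curve, but meets one of its sides. -/
theorem IsJordan.exists_exterior (hg : IsJordan g L) (K : ℝ) :
    ∃ R, 0 ≤ R ∧ Disjoint {z : ℂ | R < ‖z‖} (range g) ∧
      (({z : ℂ | R < ‖z‖} ∩ leftSide g K).Nonempty ∨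
        ({z : ℂ | R < ‖z‖} ∩ rightSide g K).Nonempty) := by
  have hL := hg.pos
  -- At a point farthest from the origin the outward ray is normal to the curve. It starts in the
  -- left or the right side according to the sign of `y`, and it stays outside the disc.
  obtain ⟨u, hu, hmax⟩ := (isCompact_Icc (a := (0 : ℝ)) (b := L)).exists_isMaxOn
    (f := fun u => ‖g u‖) ⟨0, by simp [hL.le]⟩ hg.smooth.continuous.norm.continuousOn
  have hmax' : ∀ r, ‖g r‖ ≤ ‖g u‖ := by
    intro r
    obtain ⟨r', hr', h, -⟩ := hg.exists_window 0 r
    rw [zero_add] at hr'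
    rw [← h]
    exact hmax (Ico_subset_Icc_self hr')
  have hne : g u ≠ 0 := by
    intro h
    have h0 : ∀ r, g r = 0 := fun r => by
      have := hmax' r
      rwa [h, norm_zero, norm_le_zero_iff] at this
    exact hg.inj 0 (L / 2) (by linarith) (by linarith) (by rw [h0, h0])
  refine ⟨‖g u‖, norm_nonneg _, ?_, ?_⟩
  · rw [disjoint_left]
    rintro _ hz ⟨r, rfl⟩
    have h1 := hmax' r
    have h2 : ‖g u‖ < ‖g r‖ := hz
    linarith
  have hloc : IsLocalMax (fun r => ‖g r‖ ^ 2) u := by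
    refine Eventually.of_forall fun r => ?_
    have := hmax' r
    simp only
    gcongr
  have hder : HasDerivAt (fun r => ‖g r‖ ^ 2) _ u := ((hg.differentiable u).hasDerivAt).norm_sq
  have h0 := hloc.hasDerivAt_eq_zero hder
  set T := deriv g u with hT
  have hre : (T / g u).re = 0 := by
    rw [Complex.inner] at h0
    have h2 : T.re * (g u).re + T.im * (g u).im = 0 := by
      simp only [Complex.mul_re, Complex.conj_re, Complex.conj_im] at h0
      linarith
    rw [Complex.div_re, ← add_div, h2, zero_div]
  set y := (T / g u).im with hy
  have hy0 : y ≠ 0 := by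
    intro h
    exact div_ne_zero (hg.regular u) hne (Complex.ext hre h)
  have hpt : ∀ η : ℝ, (T / (g u + η * g u - g u)).im = η⁻¹ * y := by
    intro η
    have : T / (g u + η * g u - g u) = ((η⁻¹ : ℝ) : ℂ) * (T / g u) := by
      rw [add_sub_cancel_left]
      push_cast
      rw [div_mul_eq_div_div_swap]
      ring
    rw [this, Complex.im_ofReal_mul]
  have hext : ∀ η : ℝ, 0 < η → ‖g u‖ < ‖g u + η * g u‖ := by
    intro η hη
    have : g u + η * g u = ((1 + η : ℝ) : ℂ) * g u := by push_cast; ring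
    rw [this, norm_mul, Complex.norm_real, Real.norm_eq_abs, abs_of_pos (by linarith)]
    have := norm_pos_iff.2 hne
    nlinarith
  rcases lt_or_gt_of_ne hy0 with hneg | hpos
  · left
    obtain ⟨η, h1, h2⟩ := ((tendsto_inv_nhdsGT_zero.eventually_gt_atTop (K / -y)).and
      (self_mem_nhdsWithin (a := (0 : ℝ)) (s := Ioi 0))).exists
    refine ⟨_, hext η h2, u, ?_⟩
    rw [hpt]
    rw [div_lt_iff₀ (by linarith)] at h1
    linarith
  · right
    obtain ⟨η, h1, h2⟩ := ((tendsto_inv_nhdsGT_zero.eventually_gt_atTop (K / y)).and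
      (self_mem_nhdsWithin (a := (0 : ℝ)) (s := Ioi 0))).exists
    refine ⟨_, hext η h2, u, ?_⟩
    rw [hpt]
    rwa [div_lt_iff₀ hpos] at h1

/-- Exactly one of the two sides of the curve lies in a bounded component of its complement. -/
theorem IsCurvBound.bounded_xor (hK : IsCurvBound g K) (hg : IsJordan g L) {x y : ℂ}
    (hx : x ∈ leftSide g K) (hy : y ∈ rightSide g K) :
    (Bornology.IsBounded (connectedComponentIn (range g)ᶜ x) ∧
      ¬ Bornology.IsBounded (connectedComponentIn (range g)ᶜ y)) ∨
    (¬ Bornology.IsBounded (connectedComponentIn (range g)ᶜ x) ∧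
      Bornology.IsBounded (connectedComponentIn (range g)ᶜ y)) := by
  obtain ⟨R, hR, hdisj, hside⟩ := hg.exists_exterior K
  have hxF : x ∈ (range g)ᶜ := disjoint_left.1 hK.disjoint_leftSide hx
  have hyF : y ∈ (range g)ᶜ := disjoint_left.1 hK.disjoint_rightSide hy
  have hE : {z : ℂ | R < ‖z‖} ⊆ (range g)ᶜ := subset_compl_iff_disjoint_right.2 hdisj
  have hEc := isPreconnected_exterior hR
  have hlf : leftSide g K ⊆ (range g)ᶜ := subset_compl_iff_disjoint_right.2 hK.disjoint_leftSide
  have hrt : rightSide g K ⊆ (range g)ᶜ := subset_compl_iff_disjoint_right.2 hK.disjoint_rightSide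
  have hunb : ∀ z ∈ (range g)ᶜ, ∀ p ∈ {z : ℂ | R < ‖z‖},
      connectedComponentIn (range g)ᶜ p = connectedComponentIn (range g)ᶜ z →
      ¬ Bornology.IsBounded (connectedComponentIn (range g)ᶜ z) := by
    intro z _ p hp hpz hb
    refine not_isBounded_exterior R (hb.subset ?_)
    rw [← hpz]
    exact hEc.subset_connectedComponentIn hp hE
  have hmeet : ∀ z, ¬ Bornology.IsBounded (connectedComponentIn (range g)ᶜ z) →
      {z : ℂ | R < ‖z‖} ⊆ connectedComponentIn (range g)ᶜ z := by
    intro z hz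
    obtain ⟨p, hp, hp'⟩ : ∃ p ∈ connectedComponentIn (range g)ᶜ z, R < ‖p‖ := by
      by_contra! h
      exact hz (isBounded_iff_forall_norm_le.2 ⟨R, h⟩)
    rw [_root_.connectedComponentIn_eq hp]
    exact hEc.subset_connectedComponentIn hp' hE
  -- The exterior of a large disc lies in every unbounded component, so two unbounded sides would
  -- share a component, against `separation`.
  have hnot : ¬ (¬ Bornology.IsBounded (connectedComponentIn (range g)ᶜ x) ∧
      ¬ Bornology.IsBounded (connectedComponentIn (range g)ᶜ y)) := by
    rintro ⟨h1, h2⟩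
    obtain ⟨p, hp⟩ : {z : ℂ | R < ‖z‖}.Nonempty :=
      hside.elim (fun h => h.mono inter_subset_left) (fun h => h.mono inter_subset_left)
    have h3 := _root_.connectedComponentIn_eq (hmeet x h1 hp)
    have h4 := _root_.connectedComponentIn_eq (hmeet y h2 hp)
    refine hK.separation hg (S := connectedComponentIn (range g)ᶜ x)
      isPreconnected_connectedComponentIn
      (subset_compl_iff_disjoint_right.1 (connectedComponentIn_subset _ _))
      ⟨x, mem_connectedComponentIn hxF, hx⟩ ⟨y, ?_, hy⟩
    rw [h3, ← h4]
    exact mem_connectedComponentIn hyF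
  have hor : ¬ Bornology.IsBounded (connectedComponentIn (range g)ᶜ x) ∨
      ¬ Bornology.IsBounded (connectedComponentIn (range g)ᶜ y) := by
    rcases hside with ⟨p, hp, hp'⟩ | ⟨p, hp, hp'⟩
    · exact Or.inl (hunb x hxF p hp (connectedComponentIn_eq_of_mem
        (hg.isPreconnected_leftSide hK.pos) hlf hp' hx))
    · exact Or.inr (hunb y hyF p hp (connectedComponentIn_eq_of_mem
        (hg.isPreconnected_rightSide hK.pos) hrt hp' hy))
  tauto

end support

/-! ### Vertices -/

theorem third_deriv_nonpos_of_nonpos {f f₁ f₂ : ℝ → ℝ} {m : ℝ} (h₁ : ∀ x, HasDerivAt f (f₁ x) x)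
    (h₂ : ∀ x, HasDerivAt f₁ (f₂ x) x) (h₃ : HasDerivAt f₂ m 0) (hf : ∀ x, f x ≤ 0)
    (e₀ : f 0 = 0) (e₁ : f₁ 0 = 0) (e₂ : f₂ 0 = 0) : m ≤ 0 := by
  by_contra! hm
  have hev : ∀ᶠ x in 𝓝[>] (0 : ℝ), 0 < f₂ x := by
    filter_upwards [h₃.tendsto_slope_zero_right.eventually_const_lt hm, self_mem_nhdsWithin]
      with x hx h0
    have h0' : 0 < x := h0
    rw [zero_add, e₂, sub_zero, smul_eq_mul] at hx
    exact (pos_iff_pos_of_mul_pos hx).1 (inv_pos.2 h0')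
  obtain ⟨δ, hδ, hpos⟩ := mem_nhdsGT_iff_exists_Ioo_subset.1 hev
  have hδ' : 0 < δ := hδ
  have hmono : ∀ {u v : ℝ → ℝ}, (∀ x, HasDerivAt u (v x) x) → (∀ x ∈ Ioo 0 δ, 0 < v x) →
      u 0 = 0 → ∀ x ∈ Ioo 0 δ, 0 < u x := by
    intro u v hd hv h0 x hx
    have := strictMonoOn_of_deriv_pos (convex_Icc 0 x)
      (fun y _ => (hd y).continuousAt.continuousWithinAt) (fun y hy => by
        rw [interior_Icc] at hy
        rw [(hd y).deriv]
        exact hv y ⟨hy.1, hy.2.trans hx.2⟩)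
    rw [← h0]
    exact this (left_mem_Icc.2 hx.1.le) (right_mem_Icc.2 hx.1.le) hx.1
  have h := hmono h₁ (hmono h₂ (fun x hx => hpos hx) e₁) e₀ (δ / 2) ⟨by linarith, by linarith⟩
  linarith [hf (δ / 2)]

/-- A nonzero cubic leading term changes sign at `0`. The reflection `x ↦ -x` reduces the second
inequality to the first. -/
theorem third_deriv_eq_zero_of_nonpos {f f₁ f₂ : ℝ → ℝ} {m : ℝ}
    (h₁ : ∀ x, HasDerivAt f (f₁ x) x) (h₂ : ∀ x, HasDerivAt f₁ (f₂ x) x)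
    (h₃ : HasDerivAt f₂ m 0) (hf : ∀ x, f x ≤ 0)
    (e₀ : f 0 = 0) (e₁ : f₁ 0 = 0) (e₂ : f₂ 0 = 0) : m = 0 := by
  refine le_antisymm (third_deriv_nonpos_of_nonpos h₁ h₂ h₃ hf e₀ e₁ e₂) ?_
  have hneg : ∀ {u v : ℝ → ℝ}, (∀ x, HasDerivAt u (v x) x) →
      ∀ x, HasDerivAt (fun x => u (-x)) (-v (-x)) x := by
    intro u v h x
    have := HasDerivAt.scomp x (h (-x)) (hasDerivAt_neg x)
    rwa [neg_one_smul] at this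
  have h₃' : HasDerivAt f₂ m (-0) := by rwa [neg_zero]
  have h₃'' := HasDerivAt.scomp (0 : ℝ) h₃' (hasDerivAt_neg 0)
  rw [neg_one_smul] at h₃''
  have := third_deriv_nonpos_of_nonpos (f := fun x => f (-x)) (f₁ := fun x => -f₁ (-x))
    (f₂ := fun x => f₂ (-x)) (hneg h₁) (fun x => by simpa using (hneg h₂ x).fun_neg) h₃''
    (fun x => hf _) (by simpa) (by simpa) (by simpa)
  linarith

theorem hasDerivAt_re_conj_mul {u v : ℝ → ℂ} {u' v' : ℂ} {x : ℝ} (hu : HasDerivAt u u' x)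
    (hv : HasDerivAt v v' x) :
    HasDerivAt (fun x => ((starRingEnd ℂ) (u x) * v x).re)
      (((starRingEnd ℂ) u' * v x).re + ((starRingEnd ℂ) (u x) * v').re) x := by
  have h' : HasDerivAt (fun x => (starRingEnd ℂ) (u x)) ((starRingEnd ℂ) u') x :=
    Complex.conjCLE.hasFDerivAt.comp_hasDerivAt x hu
  exact (Complex.reCLM.hasFDerivAt.comp_hasDerivAt x (h'.fun_mul hv)).congr_deriv (by simp)

theorem hasDerivAt_im_conj_mul {u v : ℝ → ℂ} {u' v' : ℂ} {x : ℝ} (hu : HasDerivAt u u' x)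
    (hv : HasDerivAt v v' x) :
    HasDerivAt (fun x => ((starRingEnd ℂ) (u x) * v x).im)
      (((starRingEnd ℂ) u' * v x).im + ((starRingEnd ℂ) (u x) * v').im) x := by
  have h' : HasDerivAt (fun x => (starRingEnd ℂ) (u x)) ((starRingEnd ℂ) u') x :=
    Complex.conjCLE.hasFDerivAt.comp_hasDerivAt x hu
  exact (Complex.imCLM.hasFDerivAt.comp_hasDerivAt x (h'.fun_mul hv)).congr_deriv (by simp)

section vertex

variable {g : ℝ → ℂ} {L : ℝ}

/-- The equation saying that the derivative of the curvature vanishes. -/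
def VertexEq (g : ℝ → ℂ) (t : ℝ) : Prop :=
  ((starRingEnd ℂ) (deriv g t) * deriv (deriv (deriv g)) t).im * Complex.normSq (deriv g t) =
    3 * ((starRingEnd ℂ) (deriv g t) * deriv (deriv g) t).im *
      ((starRingEnd ℂ) (deriv g t) * deriv (deriv g) t).re

theorem osc_eq (t : ℝ) (hT : deriv g t ≠ 0) :
    2 * osc g t * Complex.normSq (deriv g t) =
      ((starRingEnd ℂ) (deriv g t) * deriv (deriv g) t).im := by
  have hpos : Complex.normSq (deriv g t) ≠ 0 := by simpa using hT
  rw [osc, Complex.div_im, Complex.mul_im, Complex.conj_re, Complex.conj_im]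
  field_simp
  ring

/-- The function `f` below is, up to a factor, the power of `g (t + x)` with respect to the
osculating circle. Support gives it a constant sign and osculation makes it vanish to second order,
so its third derivative vanishes. With `osc_eq` this is the vertex equation. -/
theorem Osc.vertexEq (hg : IsJordan g L) {t : ℝ} (h : Osc g t) : VertexEq g t := by
  have hT := hg.regular t
  have c1 := contDiff_deriv hg.smooth
  have c2 := contDiff_deriv c1
  have d0 : ∀ x, HasDerivAt (fun x => g (t + x) - g t) (deriv g (t + x)) x := fun x =>
    ((hg.differentiable (t + x)).hasDerivAt.comp_const_add t x).sub_const _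
  have d1 : ∀ x, HasDerivAt (fun x => deriv g (t + x)) (deriv (deriv g) (t + x)) x := fun x =>
    ((c1.differentiable (by simp)) (t + x)).hasDerivAt.comp_const_add t x
  have d2 : ∀ x, HasDerivAt (fun x => deriv (deriv g) (t + x))
      (deriv (deriv (deriv g)) (t + x)) x := fun x =>
    ((c2.differentiable (by simp)) (t + x)).hasDerivAt.comp_const_add t x
  set c := osc g t with hc
  set T := deriv g t with hTdef
  have dT : ∀ x, HasDerivAt (fun _ : ℝ => T) 0 x := fun x => hasDerivAt_const x T
  have key := third_deriv_eq_zero_of_nonpos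
    (f := fun x => ((starRingEnd ℂ) T * (g (t + x) - g t)).im -
      c * ((starRingEnd ℂ) (g (t + x) - g t) * (g (t + x) - g t)).re)
    (f₁ := fun x => ((starRingEnd ℂ) T * deriv g (t + x)).im -
      c * (2 * ((starRingEnd ℂ) (g (t + x) - g t) * deriv g (t + x)).re))
    (f₂ := fun x => ((starRingEnd ℂ) T * (deriv (deriv g) (t + x))).im -
      c * (2 * (((starRingEnd ℂ) (deriv g (t + x)) * deriv g (t + x)).re +
        ((starRingEnd ℂ) (g (t + x) - g t) * deriv (deriv g) (t + x)).re)))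
    (fun x => ((hasDerivAt_im_conj_mul (dT x) (d0 x)).fun_sub
      ((hasDerivAt_re_conj_mul (d0 x) (d0 x)).const_mul c)).congr_deriv (by
        simp only [Complex.mul_re, Complex.conj_re, Complex.conj_im, map_zero, zero_mul,
          Complex.zero_im]
        ring))
    (fun x => ((hasDerivAt_im_conj_mul (dT x) (d1 x)).fun_sub
      (((hasDerivAt_re_conj_mul (d0 x) (d1 x)).const_mul 2).const_mul c)).congr_deriv (by
        simp only [map_zero, zero_mul, Complex.zero_im, zero_add]))
    ((hasDerivAt_im_conj_mul (dT 0) (d2 0)).fun_sub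
      ((((hasDerivAt_re_conj_mul (d1 0) (d1 0)).fun_add
        (hasDerivAt_re_conj_mul (d0 0) (d2 0))).const_mul 2).const_mul c))
    (fun x => by
      have := supp_iff.1 h (t + x)
      simp only [Complex.normSq_apply, Complex.mul_re, Complex.mul_im, Complex.conj_re,
        Complex.conj_im, ← hTdef, ← hc] at this ⊢
      linarith)
    (by simp) (by simp [← hTdef, mul_comm]) (by
      have := osc_eq t hT
      rw [← hTdef, ← hc, Complex.normSq_apply] at this
      simp only [add_zero, sub_self, map_zero, zero_mul, Complex.zero_re, ← hTdef]
      rw [← this]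
      simp only [Complex.mul_re, Complex.conj_re, Complex.conj_im]
      ring)
  have hosc := osc_eq t hT
  rw [← hTdef, ← hc] at hosc
  rw [VertexEq, ← hTdef]
  simp only [add_zero, sub_self, map_zero, zero_mul, Complex.zero_im, Complex.zero_re,
    ← hTdef, zero_add] at key
  have hcomm : ((starRingEnd ℂ) (deriv (deriv g) t) * T).re =
      ((starRingEnd ℂ) T * deriv (deriv g) t).re := by
    simp only [Complex.mul_re, Complex.conj_re, Complex.conj_im]; ring
  rw [hcomm] at key
  linear_combination Complex.normSq T * key +
    3 * ((starRingEnd ℂ) T * deriv (deriv g) t).re * hosc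

theorem OscRight.vertexEq (hg : IsJordan g L) {t : ℝ} (h : OscRight g t) : VertexEq g t := by
  have := Osc.vertexEq hg.rev h
  have h1 : deriv (rev g) = fun t => -deriv g (-t) := funext (deriv_rev g)
  have h2 : deriv (deriv (rev g)) = fun t => deriv (deriv g) (-t) := by
    ext t
    rw [h1, deriv.fun_neg, deriv_comp_neg, neg_neg]
  have h3 : deriv (deriv (deriv (rev g))) (-t) = -deriv (deriv (deriv g)) t := by
    rw [h2, deriv_comp_neg, neg_neg]
  rw [VertexEq, h3, h2, h1] at this
  simp only [neg_neg, map_neg, mul_neg, neg_mul, Complex.neg_im, Complex.neg_re,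
    Complex.normSq_neg] at this
  rw [VertexEq]
  linarith

end vertex

/-! ### Transfer to the Euclidean plane -/

/-- The standard isometry of the Euclidean plane with `ℂ`. -/
noncomputable def toComplex : Plane ≃ₗᵢ[ℝ] ℂ := Complex.orthonormalBasisOneI.repr.symm

theorem toComplex_re (x : Plane) : (toComplex x).re = x 0 := by
  simp [toComplex]

theorem toComplex_im (x : Plane) : (toComplex x).im = x 1 := by
  simp [toComplex]

theorem toComplex_rot (x : Plane) : toComplex (rot x) = Complex.I * toComplex x := by
  apply Complex.ext <;> simp [toComplex_re, toComplex_im, rot]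

theorem inner_rot (x y : Plane) :
    inner ℝ x (rot y) = ((starRingEnd ℂ) (toComplex y) * toComplex x).im := by
  simp only [rot, PiLp.inner_apply, Fin.sum_univ_two, RCLike.inner_apply, conj_trivial,
    Complex.mul_im, Complex.conj_re, Complex.conj_im, toComplex_re, toComplex_im]
  simp
  ring

/-- A plane curve, as a curve in `ℂ`. -/
noncomputable def complexCurve (γ : ℝ → Plane) (t : ℝ) : ℂ := toComplex (γ t)

section curve

variable {γ : ℝ → Plane} {L : ℝ}

theorem deriv_complexCurve (hγ : Differentiable ℝ γ) (t : ℝ) :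
    deriv (complexCurve γ) t = toComplex (deriv γ t) :=
  (toComplex.toContinuousLinearEquiv.hasFDerivAt.comp_hasDerivAt t (hγ t).hasDerivAt).deriv

theorem IsSmoothSimpleClosed.differentiable (hγ : IsSmoothSimpleClosed γ L) :
    Differentiable ℝ γ := hγ.smooth.differentiable (by simp)

theorem IsSmoothSimpleClosed.contDiff_deriv (hγ : IsSmoothSimpleClosed γ L) :
    ContDiff ℝ ∞ (deriv γ) := (contDiff_infty_iff_deriv.1 hγ.smooth).2

theorem IsSmoothSimpleClosed.isJordan (hγ : IsSmoothSimpleClosed γ L) :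
    IsJordan (complexCurve γ) L where
  pos := hγ.period_pos
  smooth := toComplex.toContinuousLinearEquiv.contDiff.comp hγ.smooth
  regular t := by
    rw [deriv_complexCurve hγ.differentiable]
    simpa using hγ.regular t
  periodic t := by simp only [complexCurve, hγ.periodic t]
  inj s t h1 h2 h := by
    have hL := hγ.period_pos
    have h' : γ s = γ t := toComplex.injective h
    -- Injectivity is known only on `[0, L)`. After `s` is moved there, `t` is in the same period or
    -- the next one.
    obtain ⟨n, hn, -⟩ := existsUnique_add_zsmul_mem_Ico hL s 0
    rw [zero_add] at hn
    have e1 : γ (s + n • L) = γ s := hγ.periodic.zsmul n s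
    have e2 : γ (t + n • L) = γ t := hγ.periodic.zsmul n t
    rcases lt_or_ge (t + n • L) L with h3 | h3
    · have := hγ.simple hn ⟨by linarith [hn.1], h3⟩ (by rw [e1, e2, h'])
      linarith
    · have e3 : γ (t + n • L - L) = γ t := by rw [hγ.periodic.sub_eq, e2]
      have := hγ.simple hn (x₂ := t + n • L - L) ⟨by linarith, by linarith [hn.2]⟩
        (by rw [e1, e3, h'])
      linarith

theorem deriv_deriv_complexCurve (hγ : IsSmoothSimpleClosed γ L) (t : ℝ) :
    deriv (deriv (complexCurve γ)) t = toComplex (deriv (deriv γ) t) := by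
  rw [show deriv (complexCurve γ) = complexCurve (deriv γ) from
    funext (deriv_complexCurve hγ.differentiable)]
  exact deriv_complexCurve (hγ.contDiff_deriv.differentiable (by simp)) t

theorem signedCurvature_eq (hγ : IsSmoothSimpleClosed γ L) (t : ℝ) :
    signedCurvature γ t = ((starRingEnd ℂ) (deriv (complexCurve γ) t) *
      deriv (deriv (complexCurve γ)) t).im / ‖deriv (complexCurve γ) t‖ ^ 3 := by
  have hd : HasDerivAt (deriv γ) (deriv (deriv γ) t) t :=
    ((hγ.contDiff_deriv.differentiable (by simp)) t).hasDerivAt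
  have hn : DifferentiableAt ℝ (fun t => ‖deriv γ t‖⁻¹) t :=
    (hd.differentiableAt.norm ℝ (hγ.regular t)).inv (norm_ne_zero_iff.2 (hγ.regular t))
  have htan : deriv (tangent γ) t = ‖deriv γ t‖⁻¹ • deriv (deriv γ) t +
      deriv (fun t => ‖deriv γ t‖⁻¹) t • deriv γ t := (hn.hasDerivAt.fun_smul hd).deriv
  have hpos : ‖deriv γ t‖ ≠ 0 := norm_ne_zero_iff.2 (hγ.regular t)
  rw [signedCurvature, htan, normal, inner_rot, tangent, deriv_deriv_complexCurve hγ,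
    deriv_complexCurve hγ.differentiable, toComplex.norm_map]
  simp only [map_add, map_smul, Complex.real_smul, map_mul, Complex.conj_ofReal, Complex.mul_im,
    Complex.mul_re, Complex.add_re, Complex.add_im, Complex.ofReal_re, Complex.ofReal_im,
    Complex.conj_re, Complex.conj_im]
  field_simp
  ring

theorem signedCurvature_eq_osc (hγ : IsSmoothSimpleClosed γ L) (t : ℝ) :
    osc (complexCurve γ) t = signedCurvature γ t * ‖deriv (complexCurve γ) t‖ / 2 := by
  have hT := hγ.isJordan.regular t
  have hpos : ‖deriv (complexCurve γ) t‖ ≠ 0 := norm_ne_zero_iff.2 hT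
  have h := osc_eq t hT
  rw [Complex.normSq_eq_norm_sq] at h
  rw [signedCurvature_eq hγ, ← h]
  field_simp

theorem toComplex_tangent (hγ : IsSmoothSimpleClosed γ L) (t : ℝ) :
    toComplex (tangent γ t) =
      ((‖deriv (complexCurve γ) t‖⁻¹ : ℝ) : ℂ) * deriv (complexCurve γ) t := by
  rw [tangent, map_smul, Complex.real_smul, deriv_complexCurve hγ.differentiable,
    toComplex.norm_map]

/-- With `osc` equal to half of curvature times speed, the level set of `Im w` is the tangent line
when `k = 0`. Otherwise the power identity `dist_sq_sub` with `y = 1 / (k * ‖T‖)` gives the sphere.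
-/
theorem osculatingCircle_eq (hγ : IsSmoothSimpleClosed γ L) (t : ℝ) :
    osculatingCircle γ t = toComplex ⁻¹' circ (complexCurve γ) t := by
  have hT := hγ.isJordan.regular t
  have hosc := signedCurvature_eq_osc hγ t
  have htan := toComplex_tangent hγ t
  set T := deriv (complexCurve γ) t with hTdef
  set k := signedCurvature γ t with hk
  have hpos : 0 < ‖T‖ := norm_pos_iff.2 hT
  ext x
  rw [mem_preimage, circ, mem_ofPred_eq, osculatingCircle, ← hk, ← hTdef]
  split_ifs with h0
  · rw [hosc, h0, zero_mul, zero_div, neg_eq_zero]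
    constructor
    · rintro ⟨s, rfl⟩
      right
      rw [map_add, map_smul, htan, ← complexCurve, add_sub_cancel_left, Complex.real_smul,
        div_mul_eq_div_div_swap, div_mul_cancel_right₀ hT, ← Complex.ofReal_inv,
        ← Complex.ofReal_div, Complex.ofReal_im]
    · rintro (h | h)
      · exact ⟨0, toComplex.injective (by simp [h, complexCurve])⟩
      · by_cases hx : toComplex x = complexCurve γ t
        · exact ⟨0, toComplex.injective (by simp [hx, complexCurve])⟩
        have hx' := sub_ne_zero.2 hx
        set a := (T / (toComplex x - complexCurve γ t)).re with ha
        have hTa : T / (toComplex x - complexCurve γ t) = (a : ℂ) := Complex.ext rfl h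
        have ha0 : (a : ℂ) ≠ 0 := by rw [← hTa]; exact div_ne_zero hT hx'
        refine ⟨‖T‖ / a, toComplex.injective ?_⟩
        rw [map_add, map_smul, htan, ← complexCurve, Complex.real_smul]
        rw [div_eq_iff hx'] at hTa
        have hn : (‖T‖ : ℂ) ≠ 0 := by exact_mod_cast hpos.ne'
        push_cast
        have : (‖T‖ : ℂ) / a * ((‖T‖ : ℂ)⁻¹ * T) = T / a := by field_simp
        rw [this, hTa]
        field_simp
        ring
  · set y := k⁻¹ * ‖T‖⁻¹ with hy
    have hcen : toComplex (γ t + k⁻¹ • normal γ t) =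
        complexCurve γ t + y * (Complex.I * T) := by
      rw [map_add, map_smul, normal, toComplex_rot, htan, Complex.real_smul, complexCurve, hy]
      push_cast
      ring
    have hyT : y * ‖T‖ = k⁻¹ := by rw [hy]; field_simp
    rw [Metric.mem_sphere, ← toComplex.dist_map, hcen]
    by_cases hx : toComplex x = complexCurve γ t
    · rw [hx]
      simp only [true_or, iff_true, dist_self_add_right, norm_mul, Complex.norm_I, one_mul,
        Complex.norm_real, Real.norm_eq_abs]
      rw [← abs_inv, ← hyT, abs_mul y ‖T‖, abs_norm]
    · have h1 := dist_sq_sub (g := complexCurve γ) (t := t) (y := y) hx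
      rw [← hTdef, hyT] at h1
      have hne : ‖toComplex x - complexCurve γ t‖ ^ 2 ≠ 0 :=
        pow_ne_zero _ (norm_ne_zero_iff.2 (sub_ne_zero.2 hx))
      rw [← sq_eq_sq₀ dist_nonneg (by positivity), ← abs_inv, sq_abs, ← sub_eq_zero, h1,
        mul_eq_zero, hosc]
      simp only [hne, hx, false_or]
      rw [hy]
      constructor
      · intro h
        field_simp at h
        linarith
      · intro h
        field_simp
        linarith

/-- This is the quotient rule for `k = Im (conj g' * g'') / ‖g'‖ ^ 3`. The term with `conj g'' *
g''` is real, and `‖g'‖ * ‖g'‖'` equals `Re (conj g' * g'')`. -/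
theorem VertexEq.isVertex (hγ : IsSmoothSimpleClosed γ L) {t : ℝ}
    (h : VertexEq (complexCurve γ) t) : IsVertex γ t := by
  have hg := hγ.isJordan
  have hT := hg.regular t
  have c1 := PlaneCurve.contDiff_deriv hg.smooth
  have c2 := PlaneCurve.contDiff_deriv c1
  set g := complexCurve γ with hgdef
  have d1 : HasDerivAt (deriv g) (deriv (deriv g) t) t :=
    ((c1.differentiable (by simp)) t).hasDerivAt
  have d2 : HasDerivAt (deriv (deriv g)) (deriv (deriv (deriv g)) t) t :=
    ((c2.differentiable (by simp)) t).hasDerivAt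
  have hN := hasDerivAt_im_conj_mul d1 d2
  have hn : DifferentiableAt ℝ (fun t => ‖deriv g t‖) t := d1.differentiableAt.norm ℝ hT
  have hn2 : HasDerivAt (fun t => ‖deriv g t‖ ^ 2) _ t := hn.hasDerivAt.fun_pow 2
  have hn3 := hn2.unique d1.norm_sq
  have hpos : ‖deriv g t‖ ≠ 0 := norm_ne_zero_iff.2 hT
  have hk := (hN.fun_div (hn.hasDerivAt.fun_pow 3) (pow_ne_zero 3 hpos))
  rw [IsVertex, show signedCurvature γ = _ from funext (signedCurvature_eq hγ), hk.deriv]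
  rw [VertexEq, Complex.normSq_eq_norm_sq] at h
  set n' := deriv (fun t => ‖deriv g t‖) t
  have hre : ‖deriv g t‖ * n' = ((starRingEnd ℂ) (deriv g t) * deriv (deriv g) t).re := by
    rw [Complex.inner] at hn3
    simp only [Nat.cast_ofNat, Nat.add_one_sub_one, pow_one] at hn3
    rw [mul_comm (deriv (deriv g) t)] at hn3
    linarith
  have h0 : ((starRingEnd ℂ) (deriv (deriv g) t) * deriv (deriv g) t).im = 0 := by
    simp only [Complex.mul_im, Complex.conj_re, Complex.conj_im]; ring
  rw [← hre] at h
  rw [h0, zero_add, div_eq_zero_iff]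
  left
  simp only [Nat.cast_ofNat, Nat.add_one_sub_one]
  linear_combination ‖deriv g t‖ * h

theorem connectedComponentIn_preimage_toComplex {F : Set ℂ} {x : Plane} (hx : toComplex x ∈ F) :
    connectedComponentIn (toComplex ⁻¹' F) x = toComplex ⁻¹' connectedComponentIn F (toComplex x) := by
  have h := toComplex.toHomeomorph.image_connectedComponentIn (s := toComplex ⁻¹' F) (x := x) hx
  have h2 : toComplex.toHomeomorph '' (toComplex ⁻¹' F) = F :=
    image_preimage_eq F toComplex.surjective
  rw [h2] at h
  change toComplex '' _ = connectedComponentIn F (toComplex x) at h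
  rw [← h, preimage_image_eq _ toComplex.injective]

theorem isBounded_preimage_toComplex {S : Set ℂ} :
    Bornology.IsBounded (toComplex ⁻¹' S) ↔ Bornology.IsBounded S := by
  constructor
  · intro h
    have := toComplex.lipschitz.isBounded_image h
    rwa [image_preimage_eq _ toComplex.surjective] at this
  · intro h
    exact toComplex.antilipschitz.isBounded_preimage h

theorem closure_preimage_toComplex (S : Set ℂ) :
    closure (toComplex ⁻¹' S) = toComplex ⁻¹' closure S :=
  (toComplex.toHomeomorph.preimage_closure S).symm

theorem insideRegion_preimage (S : Set ℂ) :
    insideRegion (toComplex ⁻¹' S) = toComplex ⁻¹'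
      closure {x | x ∈ Sᶜ ∧ Bornology.IsBounded (connectedComponentIn Sᶜ x)} := by
  rw [← closure_preimage_toComplex, insideRegion]
  congr 1
  ext x
  refine and_congr_right fun hx => ?_
  rw [← preimage_compl, connectedComponentIn_preimage_toComplex hx, isBounded_preimage_toComplex]

theorem outsideRegion_preimage (S : Set ℂ) :
    outsideRegion (toComplex ⁻¹' S) = toComplex ⁻¹'
      closure {x | x ∈ Sᶜ ∧ ¬ Bornology.IsBounded (connectedComponentIn Sᶜ x)} := by
  rw [← closure_preimage_toComplex, outsideRegion]
  congr 1
  ext x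
  refine and_congr_right fun hx => ?_
  rw [← preimage_compl, connectedComponentIn_preimage_toComplex hx, isBounded_preimage_toComplex]

theorem range_eq_preimage (γ : ℝ → Plane) : range γ = toComplex ⁻¹' range (complexCurve γ) := by
  rw [show complexCurve γ = toComplex ∘ γ from rfl, range_comp,
    preimage_image_eq _ toComplex.injective]

theorem globallySupports_of_exists (hγ : IsSmoothSimpleClosed γ L) {t : ℝ}
    (h : ∃ z ∈ (circ (complexCurve γ) t)ᶜ, range (complexCurve γ) ⊆
      closure (connectedComponentIn (circ (complexCurve γ) t)ᶜ z)) :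
    GloballySupports (osculatingCircle γ t) (range γ) (γ t) := by
  obtain ⟨z, hz, hsub⟩ := h
  refine ⟨?_, ⟨t, rfl⟩, toComplex.symm z, ?_, ?_⟩
  · rw [osculatingCircle_eq hγ]
    exact Or.inl rfl
  · rw [osculatingCircle_eq hγ, ← preimage_compl, mem_preimage, toComplex.apply_symm_apply]
    exact hz
  · rw [osculatingCircle_eq hγ, ← preimage_compl, connectedComponentIn_preimage_toComplex
      (by rwa [toComplex.apply_symm_apply]), toComplex.apply_symm_apply,
      closure_preimage_toComplex, range_eq_preimage]
    exact preimage_mono hsub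

theorem globallySupports_of_osc (hγ : IsSmoothSimpleClosed γ L) {t : ℝ}
    (h : Osc (complexCurve γ) t) : GloballySupports (osculatingCircle γ t) (range γ) (γ t) :=
  globallySupports_of_exists hγ (Osc.exists_component hγ.isJordan h)

theorem globallySupports_of_oscRight (hγ : IsSmoothSimpleClosed γ L) {t : ℝ}
    (h : OscRight (complexCurve γ) t) : GloballySupports (osculatingCircle γ t) (range γ) (γ t) := by
  have := Osc.exists_component hγ.isJordan.rev h
  rw [circ_rev, neg_neg, range_rev] at this
  exact globallySupports_of_exists hγ this

theorem exists_mem_Ico_of_osc (hγ : IsSmoothSimpleClosed γ L) (x : ℝ) :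
    ∃ x' ∈ Ico 0 L, complexCurve γ x' = complexCurve γ x ∧
      (Osc (complexCurve γ) x → Osc (complexCurve γ) x') ∧
      (OscRight (complexCurve γ) x → OscRight (complexCurve γ) x') := by
  have hg := hγ.isJordan
  obtain ⟨n, hn, -⟩ := existsUnique_add_zsmul_mem_Ico hg.pos x 0
  rw [zero_add] at hn
  refine ⟨_, hn, hg.periodic.zsmul n x, fun h => ?_, fun h => ?_⟩
  · rwa [hg.periodic_isOsc.zsmul n x]
  · rwa [hg.periodic_oscRight.zsmul n x]

theorem conclusion_of_four (hγ : IsSmoothSimpleClosed γ L) {a b c d : ℝ} (ha : a ∈ Ico 0 L)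
    (hb : b ∈ Ico 0 L) (hc : c ∈ Ico 0 L) (hd : d ∈ Ico 0 L) (hab : a ≠ b) (hac : a ≠ c)
    (had : a ≠ d) (hbc : b ≠ c) (hbd : b ≠ d) (hcd : c ≠ d)
    (ia : SupportsFromInside (osculatingCircle γ a) (range γ) (γ a))
    (ib : SupportsFromInside (osculatingCircle γ b) (range γ) (γ b))
    (oc : SupportsFromOutside (osculatingCircle γ c) (range γ) (γ c))
    (od : SupportsFromOutside (osculatingCircle γ d) (range γ) (γ d))
    (va : IsVertex γ a) (vb : IsVertex γ b) (vc : IsVertex γ c) (vd : IsVertex γ d) :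
    (∃ t : Fin 4 → ℝ, (∀ i, t i ∈ Set.Ico 0 L) ∧ Function.Injective t ∧
      (∀ i ∈ ({0, 1} : Set (Fin 4)), SupportsFromInside
        (osculatingCircle γ (t i)) (Set.range γ) (γ (t i))) ∧
      (∀ i ∈ ({2, 3} : Set (Fin 4)), SupportsFromOutside
        (osculatingCircle γ (t i)) (Set.range γ) (γ (t i)))) ∧
    4 ≤ {p : Plane | ∃ t : ℝ, γ t = p ∧ IsVertex γ t}.encard := by
  have hmem : ∀ i, (![a, b, c, d] : Fin 4 → ℝ) i ∈ Ico 0 L := by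
    intro i
    fin_cases i <;> assumption
  have hinj : Function.Injective (![a, b, c, d] : Fin 4 → ℝ) := by
    intro i j hij
    fin_cases i <;> fin_cases j <;> first | rfl | (exfalso; simp at hij; grind)
  have hver : ∀ i, IsVertex γ ((![a, b, c, d] : Fin 4 → ℝ) i) := by
    intro i
    fin_cases i <;> assumption
  refine ⟨⟨![a, b, c, d], hmem, hinj, ?_, ?_⟩, ?_⟩
  · rintro i (rfl | rfl) <;> assumption
  · rintro i (rfl | rfl) <;> assumption
  · have hinj' : Function.Injective fun i => γ ((![a, b, c, d] : Fin 4 → ℝ) i) :=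
      fun i j hij => hinj (hγ.simple (hmem i) (hmem j) hij)
    have h4 := hinj'.encard_range
    rw [ENat.card_eq_coe_fintype_card, Fintype.card_fin] at h4
    refine h4.trans (encard_le_encard ?_)
    rintro _ ⟨i, rfl⟩
    exact ⟨_, rfl, hver i⟩

end curve

end PlaneCurve

theorem mainTheorem7 (γ : ℝ → Plane) (L : ℝ) (hγ : PlaneCurve.IsSmoothSimpleClosed γ L) :
    (∃ t : Fin 4 → ℝ, (∀ i, t i ∈ Set.Ico 0 L) ∧ Function.Injective t ∧
      (∀ i ∈ ({0, 1} : Set (Fin 4)), PlaneCurve.SupportsFromInside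
        (PlaneCurve.osculatingCircle γ (t i)) (Set.range γ) (γ (t i))) ∧
      (∀ i ∈ ({2, 3} : Set (Fin 4)), PlaneCurve.SupportsFromOutside
        (PlaneCurve.osculatingCircle γ (t i)) (Set.range γ) (γ (t i)))) ∧
    4 ≤ {p : Plane | ∃ t : ℝ, γ t = p ∧ PlaneCurve.IsVertex γ t}.encard := by
  open PlaneCurve in
  have hg := hγ.isJordan
  obtain ⟨K, hK0, hK'⟩ := hg.exists_bound
  have hK : IsCurvBound (complexCurve γ) K := ⟨hK0, hK'⟩
  obtain ⟨ε₁, hl⟩ := (eventually_mem_leftSide (hg.regular 0) K).exists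
  obtain ⟨ε₂, hr⟩ := (eventually_mem_rightSide (hg.regular 0) K).exists
  obtain ⟨x₁, x₂, y₁, y₂, hx₁, hx₂, hy₁, hy₂, h₁, h₂, h₃, h₄, h₅, h₆⟩ :=
    hg.exists_two_osc_two_oscRight
  obtain ⟨a, ha, ea, oa, -⟩ := exists_mem_Ico_of_osc hγ x₁
  obtain ⟨b, hb, eb, ob, -⟩ := exists_mem_Ico_of_osc hγ x₂
  obtain ⟨c, hc, ec, -, oc⟩ := exists_mem_Ico_of_osc hγ y₁
  obtain ⟨d, hd, ed, -, od⟩ := exists_mem_Ico_of_osc hγ y₂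
  have hne : ∀ {u v u' v' : ℝ}, complexCurve γ u = complexCurve γ u' →
      complexCurve γ v = complexCurve γ v' → complexCurve γ u' ≠ complexCurve γ v' → u ≠ v := by
    rintro u v u' v' e1 e2 h rfl
    exact h (e1.symm.trans e2)
  have hright : ∀ {t : ℝ}, OscRight (complexCurve γ) t → ∀ {P : Set ℂ → Prop},
      P (connectedComponentIn (Set.range (complexCurve γ))ᶜ
        (complexCurve γ 0 - ε₂ * (Complex.I * deriv (complexCurve γ) 0))) →
      circ (complexCurve γ) t ⊆ closure {x | x ∈ (Set.range (complexCurve γ))ᶜ ∧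
        P (connectedComponentIn (Set.range (complexCurve γ))ᶜ x)} := by
    intro t ht P hP
    rw [← leftSide_rev] at hr
    have := Osc.circ_subset_closure hK.rev hg.rev ht hr (P := P) (by rwa [range_rev])
    rwa [circ_rev, neg_neg, range_rev] at this
  have hin : ∀ {t : ℝ}, GloballySupports (osculatingCircle γ t) (Set.range γ) (γ t) →
      circ (complexCurve γ) t ⊆ closure {x | x ∈ (Set.range (complexCurve γ))ᶜ ∧
        Bornology.IsBounded (connectedComponentIn (Set.range (complexCurve γ))ᶜ x)} →
      SupportsFromInside (osculatingCircle γ t) (Set.range γ) (γ t) := by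
    intro t h1 h2
    refine ⟨h1, ?_⟩
    rw [range_eq_preimage, insideRegion_preimage, osculatingCircle_eq hγ]
    exact Set.preimage_mono h2
  have hout : ∀ {t : ℝ}, GloballySupports (osculatingCircle γ t) (Set.range γ) (γ t) →
      circ (complexCurve γ) t ⊆ closure {x | x ∈ (Set.range (complexCurve γ))ᶜ ∧
        ¬ Bornology.IsBounded (connectedComponentIn (Set.range (complexCurve γ))ᶜ x)} →
      SupportsFromOutside (osculatingCircle γ t) (Set.range γ) (γ t) := by
    intro t h1 h2
    refine ⟨h1, ?_⟩
    rw [range_eq_preimage, outsideRegion_preimage, osculatingCircle_eq hγ]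
    exact Set.preimage_mono h2
  have va := (Osc.vertexEq hg (oa hx₁)).isVertex hγ
  have vb := (Osc.vertexEq hg (ob hx₂)).isVertex hγ
  have vc := (OscRight.vertexEq hg (oc hy₁)).isVertex hγ
  have vd := (OscRight.vertexEq hg (od hy₂)).isVertex hγ
  have ga := globallySupports_of_osc hγ (oa hx₁)
  have gb := globallySupports_of_osc hγ (ob hx₂)
  have gc := globallySupports_of_oscRight hγ (oc hy₁)
  have gd := globallySupports_of_oscRight hγ (od hy₂)
  -- The orientation is arbitrary: the circles on the left support from inside exactly when the left
  -- side is the bounded one, and otherwise the two pairs exchange roles.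
  rcases hK.bounded_xor hg hl hr with ⟨hbl, hbr⟩ | ⟨hbl, hbr⟩
  · exact conclusion_of_four hγ ha hb hc hd (hne ea eb h₁) (hne ea ec h₂) (hne ea ed h₃)
      (hne eb ec h₄) (hne eb ed h₅) (hne ec ed h₆)
      (hin ga (Osc.circ_subset_closure hK hg (oa hx₁) hl hbl))
      (hin gb (Osc.circ_subset_closure hK hg (ob hx₂) hl hbl))
      (hout gc (hright (oc hy₁) (P := fun s => ¬ Bornology.IsBounded s) hbr))
      (hout gd (hright (od hy₂) (P := fun s => ¬ Bornology.IsBounded s) hbr)) va vb vc vd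
  · exact conclusion_of_four hγ hc hd ha hb (hne ec ed h₆) (hne ea ec h₂).symm
      (hne eb ec h₄).symm (hne ea ed h₃).symm (hne eb ed h₅).symm (hne ea eb h₁)
      (hin gc (hright (oc hy₁) hbr)) (hin gd (hright (od hy₂) hbr))
      (hout ga (Osc.circ_subset_closure hK hg (oa hx₁) hl
        (P := fun s => ¬ Bornology.IsBounded s) hbl))
      (hout gb (Osc.circ_subset_closure hK hg (ob hx₂) hl
        (P := fun s => ¬ Bornology.IsBounded s) hbl)) vc vd va vb
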